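/- Let $G=(V,E)$ be a finite undirected chordal graph (for example, a chain component of an observational essential graph) and let $v\in V$. A graph on $V$ is a set of ordered pairs of nodes, an undirected edge being a pair of opposite ordered pairs. Two DAGs on $V$ are Markov equivalent if the same joint distributions (of finitely-valued variables indexed by $V$) have the Markov property with respect to them: every variable is independent of its non-descendants given its parents. The essential graph of a DAG $D$ is the graph whose edge set is the union of the edge sets of all DAGs Markov equivalent to $D$. Let $\mathbf D(G)$ be the set of all DAGs whose essential graph is $G$, i.e. the Markov equivalence class represented by $G$. For a DAG $D$ and $I\subseteq V$, let $D^{(I)}$ be obtained from $D$ by deleting all edges directed towards nodes in $I$. For a family $\mathcal I$ of subsets of $V$ (intervention targets), two DAGs are $\mathcal I$-Markov equivalent if they are statistically indistinguishable under the targets in $\mathcal I$: they admit the same families $(P^{(I)})_{I\in\mathcal I\cup\{\emptyset\}}$ of joint distributions, where a DAG $D$ admits the family if each $P^{(I)}$ is Markov with respect to $D^{(I)}$ and, for every node $a$, the conditional distribution of $X_a$ given $X_{\mathrm{pa}_D(a)}$ is the same (wherever defined) under all $P^{(I)}$ with $a\notin I$. The $\mathcal I$-essential graph $\mathcal E_{\mathcal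 I}(D)$ is the graph on $V$ whose edge set is the union of the edge sets of all DAGs $\mathcal I$-Markov equivalent to $D$, and the intervention result space is $\mathcal{IR}_{\mathcal I}(G)=\{\mathcal E_{\mathcal I}(D) : D\in\mathbf D(G)\}$. Then: 1. For $D\in\mathbf D(G)$, the graph $\mathcal E_{\{\{v\}\}}(D)$ is uniquely determined by the parent set of $v$ in $D$: if $D_1,D_2\in\mathbf D(G)$ and $\mathrm{pa}_{D_1}(v)=\mathrm{pa}_{D_2}(v)$, then $\mathcal E_{\{\{v\}\}}(D_1)=\mathcal E_{\{\{v\}\}}(D_2)$. 2. There is a bijection $\Phi$ from $\{P\subseteq \mathrm{ne}_G(v) : P\text{ is a clique}\}$ (the empty set included) onto $\mathcal{IR}_{\{\{v\}\}}(G)$ such that, for every $D\in\mathbf D(G)$, the set $\mathrm{pa}_D(v)$ is a clique contained in $\mathrm{ne}_G(v)$ and $\Phi(\mathrm{pa}_D(v))=\mathcal E_{\{\{v\}\}}(D)$. -/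

import Mathlib

namespace CausalGraph

/-! ### Graphs

A partially directed graph on the node set `V` is a `Digraph V`, that is, a set of ordered pairs of
nodes; an undirected edge `a - b` is the presence of both `(a, b)` and `(b, a)`. -/

/-- A DAG: a directed graph without directed cycles (so without loops and two-cycles either). -/
def IsDAG {V : Type*} (D : Digraph V) : Prop :=
  ∀ a, ¬ Relation.TransGen D.Adj a a

/-- The set `pa_D(a)` of parents of `a`. -/
def parents {V : Type*} (D : Digraph V) (a : V) : Set V :=
  {b | D.Adj b a}

/-- The non-descendants of `a`: the nodes other than `a` not reachable from `a` by a directed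
path. -/
def nonDescendants {V : Type*} (D : Digraph V) (a : V) : Set V :=
  {b | b ≠ a ∧ ¬ Relation.TransGen D.Adj a b}

/-- The intervention graph `D^(I)`: all edges directed towards nodes in `I` are removed. -/
def interventionGraph {V : Type*} (D : Digraph V) (I : Set V) : Digraph V :=
  ⟨fun a b => D.Adj a b ∧ b ∉ I⟩

/-- An undirected graph, viewed as a partially directed graph. -/
def ofUndirected {V : Type*} (G : SimpleGraph V) : Digraph V :=
  ⟨G.Adj⟩

/-- Every cycle of length at least four has a chord: an edge which is not part of the cycle but
connects two of its nodes. -/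
def IsChordal {V : Type*} (G : SimpleGraph V) : Prop :=
  ∀ (u : V) (c : G.Walk u u), c.IsCycle → 4 ≤ c.length →
    ∃ a b, a ∈ c.support ∧ b ∈ c.support ∧ G.Adj a b ∧ s(a, b) ∉ c.edges

/-! ### Joint distributions

The variable at the node `a` takes values in `Fin (r a)`; a joint distribution is an element of
`stdSimplex ℝ (∀ a, Fin (r a))`, that is, a nonnegative function with total mass one. -/

open Classical in
/-- The probability `P(X_S = x_S)`. -/
noncomputable def marginal {V : Type*} [Fintype V] [DecidableEq V] {r : V → ℕ}
    (p : (∀ a, Fin (r a)) → ℝ) (S : Set V) (x : ∀ a, Fin (r a)) : ℝ :=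
  ∑ y : ∀ a, Fin (r a), if ∀ a ∈ S, y a = x a then p y else 0

/-- `X_A` and `X_B` are conditionally independent given `X_C`. -/
def CondIndep {V : Type*} [Fintype V] [DecidableEq V] {r : V → ℕ}
    (p : (∀ a, Fin (r a)) → ℝ) (A B C : Set V) : Prop :=
  ∀ x, marginal p (A ∪ B ∪ C) x * marginal p C x =
    marginal p (A ∪ C) x * marginal p (B ∪ C) x

/-- The Markov property of a joint distribution with respect to `D`: any variable is independent
of its non-descendants given its parents. -/
def IsMarkov {V : Type*} [Fintype V] [DecidableEq V] {r : V → ℕ}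
    (D : Digraph V) (p : (∀ a, Fin (r a)) → ℝ) : Prop :=
  ∀ a, CondIndep p {a} (nonDescendants D a) (parents D a)

/-! ### Observational Markov equivalence -/

/-- `D₁` and `D₂` have the same Markov property: the same joint distributions are Markov with
respect to them. -/
def MarkovEquiv {V : Type*} [Fintype V] [DecidableEq V] (D₁ D₂ : Digraph V) : Prop :=
  ∀ (r : V → ℕ) (p : (∀ a, Fin (r a)) → ℝ), p ∈ stdSimplex ℝ (∀ a, Fin (r a)) →
    (IsMarkov D₁ p ↔ IsMarkov D₂ p)

/-- The (observational) essential graph of `D`: the union of the edge sets of all DAGs that are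
Markov equivalent to `D`. -/
def essentialGraph {V : Type*} [Fintype V] [DecidableEq V] (D : Digraph V) : Digraph V :=
  ⟨fun a b => ∃ D' : Digraph V, IsDAG D' ∧ MarkovEquiv D D' ∧ D'.Adj a b⟩

/-- `𝐃(G)`: all DAGs in the Markov equivalence class represented by the undirected graph `G`,
that is, the DAGs whose essential graph is `G`. -/
def dagsOf {V : Type*} [Fintype V] [DecidableEq V] (G : SimpleGraph V) : Set (Digraph V) :=
  {D | IsDAG D ∧ essentialGraph D = ofUndirected G}

/-! ### Interventional Markov equivalence -/

/-- `(p I)`, where `I` ranges over `𝓘 ∪ {∅}`, is a family of distributions that `D` can generate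
under the intervention targets in `𝓘` (and without intervention, `I = ∅`): `p I` is Markov with
respect to the intervention graph `D^(I)`, and the conditional distribution of `X_a` given
`X_pa(a)` is the same under all targets that do not contain `a`. The equality of the conditional
distributions is cross-multiplied, so that it is required where both are defined. -/
def IsInterventionalMarkov {V : Type*} [Fintype V] [DecidableEq V] {r : V → ℕ}
    (D : Digraph V) (𝓘 : Set (Set V)) (p : Set V → (∀ a, Fin (r a)) → ℝ) : Prop :=
  (∀ I ∈ insert ∅ 𝓘, IsMarkov (interventionGraph D I) (p I)) ∧
  ∀ I ∈ insert ∅ 𝓘, ∀ J ∈ insert ∅ 𝓘, ∀ a, a ∉ I → a ∉ J → ∀ x,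
    marginal (p I) ({a} ∪ parents D a) x * marginal (p J) (parents D a) x =
      marginal (p J) ({a} ∪ parents D a) x * marginal (p I) (parents D a) x

/-- `D₁ ∼_𝓘 D₂`: statistically indistinguishable under the intervention targets in `𝓘`, that is,
the same families of (observational and interventional) distributions can be generated. -/
def InterventionalMarkovEquiv {V : Type*} [Fintype V] [DecidableEq V]
    (𝓘 : Set (Set V)) (D₁ D₂ : Digraph V) : Prop :=
  ∀ (r : V → ℕ) (p : Set V → (∀ a, Fin (r a)) → ℝ),
    (∀ I ∈ insert ∅ 𝓘, p I ∈ stdSimplex ℝ (∀ a, Fin (r a))) →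
    (IsInterventionalMarkov D₁ 𝓘 p ↔ IsInterventionalMarkov D₂ 𝓘 p)

/-- The `𝓘`-essential graph `ℰ_𝓘(D)`: the union of the edge sets of all DAGs that are
`𝓘`-Markov equivalent to `D`. -/
def interventionalEssentialGraph {V : Type*} [Fintype V] [DecidableEq V]
    (𝓘 : Set (Set V)) (D : Digraph V) : Digraph V :=
  ⟨fun a b => ∃ D' : Digraph V, IsDAG D' ∧ InterventionalMarkovEquiv 𝓘 D D' ∧ D'.Adj a b⟩

/-- The intervention result space `IR_𝓘(G)`. -/
def interventionResultSpace {V : Type*} [Fintype V] [DecidableEq V]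
    (𝓘 : Set (Set V)) (G : SimpleGraph V) : Set (Digraph V) :=
  interventionalEssentialGraph 𝓘 '' dagsOf G

end CausalGraph

/-! For chordal `G`, the class `dagsOf G` consists exactly of the perfect orientations of `G`:
acyclic orientations without v-structures, i.e. with cliques as parent sets (`mem_dagsOf_iff`).
Three facts about them carry the theorem.

Sufficiency: two perfect orientations are linked by reversals of covered edges, none of which
touches a node whose parents already agree (`IsPerfectOrientation.induction`). Reversing a covered
edge `x → y`, with `S` the parents of `x`, only rewrites P(x | S) P(y | S, x) as P(y | S) P(x | S,
y). So it preserves the Markov property and, if no target contains an endpoint, also the invariance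
of the conditionals. Equal parents of `v` therefore force `{v}`-equivalence, which is part 1.

Necessity: coin distributions serve as tests. Two equal coins detect adjacency, two coins and their
parity detect colliders, and two equal coins decoupled by an intervention at `v` detect an edge into
`v`. Thus the parents of `v` can be read off the interventional essential graph
(`parents_interventionalEssentialGraph`), which makes `Φ` injective.

Existence: by a Dirac-type argument, a chordal graph can be reduced to any given clique by deleting
simplicial nodes. Hence every clique `P` of neighbors of `v` starts a perfect ordering in which `v`
comes next, and `P` is the parent set of `v` in some perfect orientation
(`IsChordal.exists_isPerfectOrientation`). The case of a singleton `P` also shows that every edge of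
`G` can be oriented either way, so the essential graph of a perfect orientation is all of `G`. -/

namespace CausalGraph

/-! ### Acyclicity and integer rankings -/

section Ranking

variable {V : Type*} {D : Digraph V}

theorem lt_of_transGen {f : V → ℤ} (hf : ∀ a b, D.Adj a b → f a < f b) {a b : V}
    (h : Relation.TransGen D.Adj a b) : f a < f b := by
  induction h with
  | single h => exact hf _ _ h
  | tail _ h ih => exact ih.trans (hf _ _ h)

theorem isDAG_of_ranking {f : V → ℤ} (hf : ∀ a b, D.Adj a b → f a < f b) : IsDAG D :=
  fun _ h => (lt_of_transGen hf h).ne rfl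

theorem IsDAG.exists_ranking [Finite V] (hD : IsDAG D) :
    ∃ f : V → ℤ, ∀ a b, D.Adj a b → f a < f b := by
  refine ⟨fun a => ({b | Relation.TransGen D.Adj b a}.ncard : ℤ), fun a b hab => ?_⟩
  have : {c | Relation.TransGen D.Adj c a} ⊂ {c | Relation.TransGen D.Adj c b} := by
    refine ⟨fun c hc => Relation.TransGen.tail hc hab, fun h => hD a (h ?_)⟩
    exact Relation.TransGen.single hab
  exact Int.ofNat_lt.2 (Set.ncard_lt_ncard this)

theorem IsDAG.not_adj_self (hD : IsDAG D) (a : V) : ¬ D.Adj a a :=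
  fun h => hD a (.single h)

theorem IsDAG.asymm (hD : IsDAG D) {a b : V} (h : D.Adj a b) : ¬ D.Adj b a :=
  fun h' => hD a (.tail (.single h) h')

theorem IsDAG.parents_subset_nonDescendants (hD : IsDAG D) (a : V) :
    parents D a ⊆ nonDescendants D a := by
  intro b hb
  refine ⟨?_, fun h => hD a (.tail h hb)⟩
  rintro rfl
  exact hD.not_adj_self _ hb

theorem IsDAG.interventionGraph (hD : IsDAG D) (I : Set V) :
    IsDAG (interventionGraph D I) :=
  fun a h => hD a (Relation.TransGen.mono (fun _ _ h => h.1) a a h)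

theorem interventionGraph_empty (D : Digraph V) : interventionGraph D ∅ = D := by
  ext; simp [interventionGraph]

theorem parents_interventionGraph_of_mem {I : Set V} {a : V} (ha : a ∈ I) :
    parents (interventionGraph D I) a = ∅ := by
  ext; simp [interventionGraph, parents, ha]

theorem parents_interventionGraph_of_notMem {I : Set V} {a : V} (ha : a ∉ I) :
    parents (interventionGraph D I) a = parents D a := by
  ext; simp [interventionGraph, parents, ha]

end Ranking

/-! ### Marginals of joint distributions -/

section Marginal

variable {V : Type*} [Fintype V] [DecidableEq V] {r : V → ℕ} {p : (∀ a, Fin (r a)) → ℝ}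

theorem marginal_nonneg (hp : ∀ y, 0 ≤ p y) (S : Set V) (x : ∀ a, Fin (r a)) :
    0 ≤ marginal p S x := by
  classical
  refine Finset.sum_nonneg fun y _ => ?_
  split_ifs
  exacts [hp y, le_rfl]

theorem marginal_anti (hp : ∀ y, 0 ≤ p y) {S T : Set V} (h : S ⊆ T) (x : ∀ a, Fin (r a)) :
    marginal p T x ≤ marginal p S x := by
  classical
  refine Finset.sum_le_sum fun y _ => ?_
  split_ifs with h1 h2 h2
  · exact le_rfl
  · exact (h2 fun a ha => h1 a (h ha)).elim
  · exact hp y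
  · exact le_rfl

theorem marginal_eq_zero_of_subset (hp : ∀ y, 0 ≤ p y) {S T : Set V} (h : S ⊆ T)
    {x : ∀ a, Fin (r a)} (h0 : marginal p S x = 0) : marginal p T x = 0 :=
  le_antisymm (h0 ▸ marginal_anti hp h x) (marginal_nonneg hp T x)

theorem marginal_congr {S : Set V} {x y : ∀ a, Fin (r a)} (h : ∀ a ∈ S, x a = y a) :
    marginal p S x = marginal p S y := by
  classical
  refine Finset.sum_congr rfl fun z _ => ?_
  have : (∀ a ∈ S, z a = x a) ↔ ∀ a ∈ S, z a = y a :=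
    forall₂_congr fun a ha => by rw [h a ha]
  simp only [this]

theorem marginal_update {S : Set V} {e : V} (he : e ∉ S) (x : ∀ a, Fin (r a)) (i : Fin (r e)) :
    marginal p S (Function.update x e i) = marginal p S x :=
  marginal_congr fun _ ha => Function.update_of_ne (ne_of_mem_of_not_mem ha he) _ _

theorem marginal_univ (x : ∀ a, Fin (r a)) : marginal p Set.univ x = p x := by
  classical
  simp [marginal, ← funext_iff]

theorem marginal_empty (x : ∀ a, Fin (r a)) : marginal p ∅ x = ∑ y, p y := by
  simp [marginal]

theorem sum_marginal_insert {S : Set V} {b : V} (hb : b ∉ S) (x : ∀ a, Fin (r a)) :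
    ∑ i, marginal p (insert b S) (Function.update x b i) = marginal p S x := by
  classical
  unfold marginal
  rw [Finset.sum_comm]
  refine Finset.sum_congr rfl fun y _ => ?_
  have : ∀ i, (∀ a ∈ insert b S, y a = Function.update x b i a) ↔
      i = y b ∧ ∀ a ∈ S, y a = x a := by
    intro i
    rw [Set.forall_mem_insert, Function.update_self, eq_comm]
    refine and_congr_right fun _ => forall₂_congr fun a ha => ?_
    rw [Function.update_of_ne (ne_of_mem_of_not_mem ha hb)]
  simp only [this, ite_and, Finset.sum_ite_eq', Finset.mem_univ, if_true]

/-- Linear relations between marginals may be summed over the coordinates in `E`. -/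
theorem marginal_relation_of_union (E : Finset V) {A B : Set V} (hA : ∀ e ∈ E, e ∉ A)
    (hB : ∀ e ∈ E, e ∉ B) {k₁ k₂ : (∀ a, Fin (r a)) → ℝ}
    (h₁ : ∀ e ∈ E, ∀ x i, k₁ (Function.update x e i) = k₁ x)
    (h₂ : ∀ e ∈ E, ∀ x i, k₂ (Function.update x e i) = k₂ x)
    (h : ∀ x, k₁ x * marginal p (A ∪ E) x = k₂ x * marginal p (B ∪ E) x) (x : ∀ a, Fin (r a)) :
    k₁ x * marginal p A x = k₂ x * marginal p B x := by
  induction E using Finset.induction_on generalizing x with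
  | empty => simpa using h x
  | insert e E heE ih =>
    refine ih (fun e he => hA e (by simp [he])) (fun e he => hB e (by simp [he]))
      (fun e he => h₁ e (by simp [he])) (fun e he => h₂ e (by simp [he])) (fun x => ?_) x
    have hA' : e ∉ A ∪ E := by simp [hA e (by simp), heE]
    have hB' : e ∉ B ∪ E := by simp [hB e (by simp), heE]
    rw [← sum_marginal_insert hA', ← sum_marginal_insert hB', Finset.mul_sum, Finset.mul_sum]
    refine Finset.sum_congr rfl fun i _ => ?_
    have := h (Function.update x e i)
    rwa [h₁ e (by simp), h₂ e (by simp), Finset.coe_insert, Set.union_insert,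
      Set.union_insert] at this

end Marginal

/-! ### The Markov property as a factorization -/

section Factorization

variable {V : Type*} [Fintype V] [DecidableEq V] {r : V → ℕ} {D : Digraph V}
  {p : (∀ a, Fin (r a)) → ℝ}

/-- The conditional probability of `x a` given the values of the nodes in `S`. -/
noncomputable def condProb (p : (∀ a, Fin (r a)) → ℝ) (a : V) (S : Set V)
    (x : ∀ a, Fin (r a)) : ℝ :=
  marginal p (insert a S) x / marginal p S x

theorem condProb_nonneg (hp : ∀ y, 0 ≤ p y) (a : V) (S : Set V) (x : ∀ a, Fin (r a)) :
    0 ≤ condProb p a S x :=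
  div_nonneg (marginal_nonneg hp _ _) (marginal_nonneg hp _ _)

/-- The Markov property speaks of all non-descendants at once; those outside `B` are summed out. -/
theorem IsMarkov.marginal_insert (hD : IsDAG D) (h : IsMarkov D p) {a : V} {B : Set V}
    (h₁ : parents D a ⊆ B) (h₂ : B ⊆ nonDescendants D a) (x : ∀ a, Fin (r a)) :
    marginal p (parents D a) x * marginal p (insert a B) x =
      marginal p (insert a (parents D a)) x * marginal p B x := by
  classical
  have haN : a ∉ nonDescendants D a := fun h => h.1 rfl
  have hN := hD.parents_subset_nonDescendants a
  refine marginal_relation_of_union (nonDescendants D a \ B).toFinset ?_ ?_ ?_ ?_ ?_ x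
  · intro e he
    rw [Set.mem_toFinset] at he
    rintro (rfl | h)
    exacts [haN he.1, he.2 h]
  · intro e he
    rw [Set.mem_toFinset] at he
    exact he.2
  · intro e he x i
    rw [Set.mem_toFinset] at he
    exact marginal_update (fun h => he.2 (h₁ h)) x i
  · intro e he x i
    rw [Set.mem_toFinset] at he
    refine marginal_update ?_ x i
    rintro (rfl | h)
    exacts [haN he.1, he.2 (h₁ h)]
  · intro x
    have := h a x
    rw [Set.union_assoc, Set.union_eq_self_of_subset_right hN, ← Set.insert_eq,
      ← Set.insert_eq] at this
    rw [Set.coe_toFinset, Set.insert_union, Set.union_sdiff_cancel h₂, mul_comm, this]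

theorem IsMarkov.marginal_eq_prod (hD : IsDAG D) (hp : p ∈ stdSimplex ℝ (∀ a, Fin (r a)))
    (h : IsMarkov D p) (A : Finset V) (hA : ∀ a ∈ A, parents D a ⊆ A) (x : ∀ a, Fin (r a)) :
    marginal p A x = ∏ a ∈ A, condProb p a (parents D a) x := by
  obtain ⟨f, hf⟩ := hD.exists_ranking
  induction A using Finset.strongInduction with
  | H A ih =>
    rcases A.eq_empty_or_nonempty with rfl | hne
    · simp [marginal_empty, hp.2]
    -- Once a node of maximal rank is split off, the rest is still closed under parents and contains
    -- no descendant of it.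
    obtain ⟨a, haA, hmax⟩ := A.exists_max_image f hne
    have hB : ∀ b ∈ A.erase a, parents D b ⊆ (A.erase a : Finset V) := by
      intro b hb c hc
      have hb' := Finset.mem_of_mem_erase hb
      refine Finset.mem_coe.2 (Finset.mem_erase.2 ⟨?_, hA b hb' hc⟩)
      rintro rfl
      exact absurd (hf _ _ hc) (not_lt.2 (hmax b hb'))
    have hpa : parents D a ⊆ (A.erase a : Finset V) := fun c hc =>
      Finset.mem_coe.2 (Finset.mem_erase.2
        ⟨fun h => hD.not_adj_self a (h ▸ hc), hA a haA hc⟩)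
    have hnd : ((A.erase a : Finset V) : Set V) ⊆ nonDescendants D a := fun b hb =>
      ⟨Finset.ne_of_mem_erase hb, fun h =>
        absurd (lt_of_transGen hf h) (not_lt.2 (hmax b (Finset.mem_of_mem_erase hb)))⟩
    have key := h.marginal_insert hD hpa hnd x
    rw [← Finset.coe_insert, Finset.insert_erase haA] at key
    rw [← Finset.mul_prod_erase A _ haA, ← ih _ (Finset.erase_ssubset haA) hB, condProb]
    rcases eq_or_ne (marginal p (parents D a) x) 0 with h0 | h0
    · rw [h0, div_zero, zero_mul]
      exact marginal_eq_zero_of_subset hp.1 (hA a haA) h0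
    · field_simp
      linarith

theorem IsMarkov.eq_prod (hD : IsDAG D) (hp : p ∈ stdSimplex ℝ (∀ a, Fin (r a)))
    (h : IsMarkov D p) (x : ∀ a, Fin (r a)) :
    p x = ∏ a, condProb p a (parents D a) x := by
  have := h.marginal_eq_prod hD hp Finset.univ (by simp) x
  rwa [Finset.coe_univ, marginal_univ] at this

/-- A lowest-ranked node `b` outside `A` has all its parents in `A`, so `insert b A` is again closed
under parents, and summing over the value at `b` removes the factor `k b`. -/
theorem marginal_prod_kernel (hD : IsDAG D) {k : V → (∀ a, Fin (r a)) → ℝ}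
    (hk : ∀ a x y, (∀ b ∈ insert a (parents D a), x b = y b) → k a x = k a y)
    (hsum : ∀ a x, ∑ i, k a (Function.update x a i) = 1) (A : Finset V)
    (hA : ∀ a ∈ A, parents D a ⊆ A) (x : ∀ a, Fin (r a)) :
    marginal (fun x => ∏ a, k a x) A x = ∏ a ∈ A, k a x := by
  obtain ⟨f, hf⟩ := hD.exists_ranking
  induction hn : (Aᶜ).card generalizing A x with
  | zero =>
    obtain rfl : A = Finset.univ := by simpa using hn
    rw [Finset.coe_univ, marginal_univ]
  | succ n ih =>
    obtain ⟨b, hb, hmin⟩ := Aᶜ.exists_min_image f (Finset.card_pos.1 (by omega))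
    have hbA : b ∉ A := by simpa using hb
    have hpa : parents D b ⊆ A := by
      intro c hc
      by_contra hcA
      exact absurd (hf _ _ hc) (not_lt.2 (hmin c (by simpa using hcA)))
    have hA' : ∀ a ∈ insert b A, parents D a ⊆ (insert b A : Finset V) := by
      intro a ha
      rw [Finset.coe_insert]
      refine Set.Subset.trans ?_ (Set.subset_insert _ _)
      rcases Finset.mem_insert.1 ha with rfl | ha
      exacts [hpa, hA a ha]
    have hcard : ((insert b A)ᶜ).card = n := by
      rw [Finset.compl_insert, Finset.card_erase_of_mem hb, hn, Nat.add_sub_cancel]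
    rw [← sum_marginal_insert (show b ∉ (A : Set V) from hbA)]
    have : ∀ i, marginal (fun x => ∏ a, k a x) (insert b (A : Set V)) (Function.update x b i) =
        k b (Function.update x b i) * ∏ a ∈ A, k a x := by
      intro i
      rw [← Finset.coe_insert, ih _ hA' _ hcard, Finset.prod_insert hbA]
      congr 1
      refine Finset.prod_congr rfl fun a ha => hk a _ _ fun c hc => ?_
      refine Function.update_of_ne ?_ _ _
      rintro rfl
      rcases hc with rfl | hc
      exacts [hbA ha, hbA (hA a ha hc)]
    rw [Finset.sum_congr rfl fun i _ => this i, ← Finset.sum_mul, hsum, one_mul]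

/-- The non-descendants of `a` are closed under parents, with or without `a` added, so the two
marginals differ by the factor `k a`. Summing down to the parents of `a` leaves the same factor. -/
theorem isMarkov_prod_kernel (hD : IsDAG D) {k : V → (∀ a, Fin (r a)) → ℝ}
    (hk : ∀ a x y, (∀ b ∈ insert a (parents D a), x b = y b) → k a x = k a y)
    (hsum : ∀ a x, ∑ i, k a (Function.update x a i) = 1) :
    IsMarkov D (fun x => ∏ a, k a x) := by
  classical
  intro a
  set p : (∀ a, Fin (r a)) → ℝ := fun x => ∏ a, k a x
  have haN : a ∉ nonDescendants D a := fun h => h.1 rfl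
  have hN := hD.parents_subset_nonDescendants a
  have hNanc : ∀ b ∈ nonDescendants D a, parents D b ⊆ nonDescendants D a := by
    intro b hb c hc
    refine ⟨?_, fun h => hb.2 (h.tail hc)⟩
    rintro rfl
    exact hb.2 (.single hc)
  have key : ∀ x, marginal p (insert a (nonDescendants D a)) x =
      k a x * marginal p (nonDescendants D a) x := by
    intro x
    have h₁ := marginal_prod_kernel hD hk hsum (nonDescendants D a).toFinset
      (by simpa using hNanc) x
    have h₂ := marginal_prod_kernel hD hk hsum (insert a (nonDescendants D a).toFinset) (by
      intro b hb
      rw [Finset.coe_insert, Set.coe_toFinset]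
      refine Set.Subset.trans ?_ (Set.subset_insert _ _)
      rcases Finset.mem_insert.1 hb with rfl | hb
      exacts [hN, hNanc b (by simpa using hb)]) x
    rw [Finset.coe_insert, Finset.prod_insert (by simpa using haN), ← h₁, Set.coe_toFinset] at h₂
    exact h₂
  have key' : ∀ x, 1 * marginal p (insert a (parents D a)) x =
      k a x * marginal p (parents D a) x := by
    refine marginal_relation_of_union (nonDescendants D a \ parents D a).toFinset
      ?_ ?_ (fun _ _ _ _ => rfl) ?_ ?_
    · intro e he
      rw [Set.mem_toFinset] at he
      rintro (rfl | h)
      exacts [haN he.1, he.2 h]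
    · intro e he
      rw [Set.mem_toFinset] at he
      exact he.2
    · intro e he x i
      rw [Set.mem_toFinset] at he
      refine hk a _ _ fun b hb => Function.update_of_ne ?_ _ _
      rintro rfl
      rcases hb with rfl | hb
      exacts [haN he.1, he.2 hb]
    · intro x
      rw [Set.coe_toFinset, Set.insert_union, Set.union_sdiff_cancel hN, one_mul, key]
  intro x
  have := key' x
  rw [Set.union_assoc, Set.union_eq_self_of_subset_right hN, ← Set.insert_eq, ← Set.insert_eq,
    key]
  linear_combination (-marginal p (nonDescendants D a) x) * this

theorem sum_condProb {a : V} {S : Set V} (ha : a ∉ S) {x : ∀ a, Fin (r a)}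
    (h0 : marginal p S x ≠ 0) : ∑ i, condProb p a S (Function.update x a i) = 1 := by
  simp only [condProb, marginal_update ha]
  rw [← Finset.sum_div, sum_marginal_insert ha, div_self h0]

theorem isMarkov_of_eq_prod (hD : IsDAG D) (hp : p ∈ stdSimplex ℝ (∀ a, Fin (r a)))
    (h : ∀ x, p x = ∏ a, condProb p a (parents D a) x) : IsMarkov D p := by
  classical
  -- `condProb` is zero, hence not a kernel, where the parents have probability zero. The uniform
  -- law is substituted there; this can only enlarge the product, and equality follows since both
  -- sides have total mass one.
  let k : V → (∀ a, Fin (r a)) → ℝ := fun a x =>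
    if marginal p (parents D a) x = 0 then (r a : ℝ)⁻¹ else condProb p a (parents D a) x
  have hk : ∀ a x y, (∀ b ∈ insert a (parents D a), x b = y b) → k a x = k a y := by
    intro a x y hxy
    simp only [k, condProb, marginal_congr hxy,
      marginal_congr fun b hb => hxy b (Set.mem_insert_of_mem a hb)]
  have hsum : ∀ a x, ∑ i, k a (Function.update x a i) = 1 := by
    intro a x
    have ha : a ∉ parents D a := hD.not_adj_self a
    simp only [k, marginal_update ha]
    split_ifs with h0
    · have : (r a : ℝ) ≠ 0 := by exact_mod_cast (x a).pos.ne'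
      simp [this]
    · exact sum_condProb ha h0
  have hle : ∀ x, p x ≤ ∏ a, k a x := by
    intro x
    rw [h]
    refine Finset.prod_le_prod (fun a _ => condProb_nonneg hp.1 _ _ _) fun a _ => ?_
    simp only [k]
    split_ifs with h0
    · rw [condProb, h0, div_zero]
      positivity
    · exact le_rfl
  have htot : ∑ x, p x = ∑ x, ∏ a, k a x := by
    obtain ⟨x⟩ : Nonempty (∀ a, Fin (r a)) := by
      by_contra hempty
      rw [not_nonempty_iff] at hempty
      simpa using hp.2
    have := marginal_prod_kernel hD hk hsum ∅ (by simp) x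
    rw [Finset.coe_empty, marginal_empty, Finset.prod_empty] at this
    rw [this, hp.2]
  have heq : p = fun x => ∏ a, k a x :=
    funext fun x => (Finset.sum_eq_sum_iff_of_le fun x _ => hle x).1 htot x (Finset.mem_univ x)
  rw [heq]
  exact isMarkov_prod_kernel hD hk hsum

end Factorization

/-! ### Reversal of a covered edge -/

section CoveredReversal

/-- `D'` arises from `D` by reversing the covered edge `x → y`, that is, an edge whose endpoints
have the same parents (apart from `x` itself). -/
structure CoveredReversal {V : Type*} (D D' : Digraph V) (x y : V) : Prop where
  isDAG : IsDAG D
  isDAG' : IsDAG D'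
  ne : x ≠ y
  parents_right : parents D y = insert x (parents D x)
  parents_left' : parents D' x = insert y (parents D x)
  parents_right' : parents D' y = parents D x
  parents_eq : ∀ a, a ≠ x → a ≠ y → parents D' a = parents D a

variable {V : Type*} {D D' : Digraph V} {x y : V}

theorem CoveredReversal.symm (h : CoveredReversal D D' x y) : CoveredReversal D' D y x where
  isDAG := h.isDAG'
  isDAG' := h.isDAG
  ne := h.ne.symm
  parents_right := by rw [h.parents_left', h.parents_right']
  parents_left' := by rw [h.parents_right, h.parents_right']
  parents_right' := h.parents_right'.symm
  parents_eq a h₁ h₂ := (h.parents_eq a h₂ h₁).symm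

theorem CoveredReversal.interventionGraph (h : CoveredReversal D D' x y) {I : Set V}
    (hx : x ∉ I) (hy : y ∉ I) :
    CoveredReversal (interventionGraph D I) (interventionGraph D' I) x y where
  isDAG := h.isDAG.interventionGraph I
  isDAG' := h.isDAG'.interventionGraph I
  ne := h.ne
  parents_right := by
    simpa only [parents_interventionGraph_of_notMem, hx, hy, not_false_eq_true]
      using h.parents_right
  parents_left' := by
    simpa only [parents_interventionGraph_of_notMem, hx, hy, not_false_eq_true]
      using h.parents_left'
  parents_right' := by
    simpa only [parents_interventionGraph_of_notMem, hx, hy, not_false_eq_true]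
      using h.parents_right'
  parents_eq a h₁ h₂ := by
    by_cases ha : a ∈ I
    · simp only [parents_interventionGraph_of_mem ha]
    · simpa only [parents_interventionGraph_of_notMem ha] using h.parents_eq a h₁ h₂

variable [Fintype V] [DecidableEq V] {r : V → ℕ} {p q : (∀ a, Fin (r a)) → ℝ}

theorem condProb_mul_condProb (hp : ∀ y, 0 ≤ p y) (a b : V) (S : Set V) (x : ∀ a, Fin (r a)) :
    condProb p a S x * condProb p b (insert a S) x =
      marginal p (insert b (insert a S)) x / marginal p S x := by
  unfold condProb
  rcases eq_or_ne (marginal p (insert a S) x) 0 with h0 | h0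
  · rw [h0, marginal_eq_zero_of_subset hp (Set.subset_insert b _) h0]
    simp
  · field_simp

/-- In either factorization the factors at `x` and `y` multiply to the joint conditional of both
given the common parents; all other factors agree. -/
theorem CoveredReversal.isMarkov (h : CoveredReversal D D' x y)
    (hp : p ∈ stdSimplex ℝ (∀ a, Fin (r a))) (hM : IsMarkov D p) : IsMarkov D' p := by
  refine isMarkov_of_eq_prod h.isDAG' hp fun z => ?_
  have hy : y ∈ Finset.univ.erase x := Finset.mem_erase.2 ⟨h.ne.symm, Finset.mem_univ y⟩
  rw [hM.eq_prod h.isDAG hp, ← Finset.mul_prod_erase _ _ (Finset.mem_univ x),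
    ← Finset.mul_prod_erase _ _ hy, ← Finset.mul_prod_erase _ _ (Finset.mem_univ x),
    ← Finset.mul_prod_erase _ _ hy, ← mul_assoc, ← mul_assoc, h.parents_right, h.parents_left',
    h.parents_right', condProb_mul_condProb hp.1, mul_comm (condProb p x _ z),
    condProb_mul_condProb hp.1, Set.insert_comm]
  congr 1
  refine Finset.prod_congr rfl fun a ha => ?_
  simp only [Finset.mem_erase] at ha
  rw [h.parents_eq a ha.2.1 ha.1]

theorem CoveredReversal.markovEquiv (h : CoveredReversal D D' x y) : MarkovEquiv D D' :=
  fun _ _ hp => ⟨h.isMarkov hp, h.symm.isMarkov hp⟩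

/-- The conditional distribution of `X_a` given `X_S` is the same under `p` and `q`. -/
def SameCond (p q : (∀ a, Fin (r a)) → ℝ) (a : V) (S : Set V) : Prop :=
  ∀ x, marginal p (insert a S) x * marginal q S x = marginal q (insert a S) x * marginal p S x

/-- By the chain rule, `p` and `q` agree on the joint law of `a` and `b` given `S`, which determines
the two conditionals in the other order. As the equalities are cross-multiplied, vanishing marginals
need separate treatment. -/
theorem sameCond_reversal (hp : ∀ y, 0 ≤ p y) (hq : ∀ y, 0 ≤ q y) {a b : V} {S : Set V}
    (hab : a ≠ b) (haS : a ∉ S) (ha : SameCond p q a S) (hb : SameCond p q b (insert a S)) :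
    SameCond p q b S ∧ SameCond p q a (insert b S) := by
  have hjoint : ∀ x, marginal p (insert a (insert b S)) x * marginal q S x =
      marginal q (insert a (insert b S)) x * marginal p S x := by
    intro x
    rw [Set.insert_comm a b S]
    have h₁ := ha x
    have h₂ := hb x
    have hpz : marginal p (insert a S) x = 0 → marginal p (insert b (insert a S)) x = 0 :=
      marginal_eq_zero_of_subset hp (Set.subset_insert b _)
    have hqz : marginal q (insert a S) x = 0 → marginal q (insert b (insert a S)) x = 0 :=
      marginal_eq_zero_of_subset hq (Set.subset_insert b _)
    rcases eq_or_ne (marginal p (insert a S) x) 0 with h0 | h0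
    · rw [h0, zero_mul, eq_comm, mul_eq_zero] at h₁
      rcases h₁ with h₁ | h₁
      · rw [hpz h0, hqz h₁, zero_mul, zero_mul]
      · rw [hpz h0, h₁, zero_mul, mul_zero]
    · rcases eq_or_ne (marginal q (insert a S) x) 0 with h0' | h0'
      · rw [h0', zero_mul, mul_eq_zero] at h₁
        rcases h₁ with h₁ | h₁
        · exact absurd h₁ h0
        · rw [h₁, hqz h0', zero_mul, mul_zero]
      · refine mul_left_cancel₀ (mul_ne_zero h0 h0') ?_
        linear_combination (marginal q (insert a S) x * marginal p (insert b (insert a S)) x) * h₁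
          + (marginal q (insert a S) x * marginal p S x) * h₂
  have hbS : SameCond p q b S := by
    intro x
    have ha' : a ∉ insert b S := by
      rintro (h | h)
      exacts [hab h, haS h]
    rw [← sum_marginal_insert ha', ← sum_marginal_insert ha', Finset.sum_mul, Finset.sum_mul]
    refine Finset.sum_congr rfl fun i _ => ?_
    have := hjoint (Function.update x a i)
    rwa [marginal_update haS, marginal_update haS] at this
  refine ⟨hbS, fun x => ?_⟩
  have h₁ := hjoint x
  have h₂ := hbS x
  have hsub : S ⊆ insert a (insert b S) :=
    (Set.subset_insert _ _).trans (Set.subset_insert _ _)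
  rcases eq_or_ne (marginal p S x) 0 with h0 | h0
  · rw [marginal_eq_zero_of_subset hp hsub h0,
      marginal_eq_zero_of_subset hp (Set.subset_insert b S) h0]
    simp
  rcases eq_or_ne (marginal q S x) 0 with h0' | h0'
  · rw [marginal_eq_zero_of_subset hq hsub h0',
      marginal_eq_zero_of_subset hq (Set.subset_insert b S) h0']
    simp
  · refine mul_left_cancel₀ (mul_ne_zero h0 h0') ?_
    linear_combination (marginal p S x * marginal q (insert b S) x) * h₁
      - (marginal p S x * marginal q (insert a (insert b S)) x) * h₂

theorem CoveredReversal.isInterventionalMarkov (h : CoveredReversal D D' x y)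
    {𝓘 : Set (Set V)} (hI : ∀ I ∈ 𝓘, x ∉ I ∧ y ∉ I) {p : Set V → (∀ a, Fin (r a)) → ℝ}
    (hp : ∀ I ∈ insert ∅ 𝓘, p I ∈ stdSimplex ℝ (∀ a, Fin (r a)))
    (hM : IsInterventionalMarkov D 𝓘 p) : IsInterventionalMarkov D' 𝓘 p := by
  have hI' : ∀ I ∈ insert ∅ 𝓘, x ∉ I ∧ y ∉ I := by
    rintro I (rfl | hI₁)
    exacts [⟨Set.notMem_empty _, Set.notMem_empty _⟩, hI I hI₁]
  refine ⟨fun I hI₁ => (h.interventionGraph (hI' I hI₁).1 (hI' I hI₁).2).isMarkov (hp I hI₁)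
    (hM.1 I hI₁), fun I hI₁ J hJ₁ a haI haJ => ?_⟩
  have hS : ∀ b, b ∉ I → b ∉ J → SameCond (p I) (p J) b (parents D b) := hM.2 I hI₁ J hJ₁
  have hxx : x ∉ parents D x := h.isDAG.not_adj_self x
  obtain ⟨h₁, h₂⟩ := sameCond_reversal (hp I hI₁).1 (hp J hJ₁).1 h.ne hxx
    (hS x (hI' I hI₁).1 (hI' J hJ₁).1)
    (h.parents_right ▸ hS y (hI' I hI₁).2 (hI' J hJ₁).2)
  change SameCond (p I) (p J) a (parents D' a)
  rcases eq_or_ne a x with rfl | hx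
  · rwa [h.parents_left']
  rcases eq_or_ne a y with rfl | hy
  · rwa [h.parents_right']
  · rw [h.parents_eq a hx hy]
    exact hS a haI haJ

theorem CoveredReversal.interventionalMarkovEquiv (h : CoveredReversal D D' x y)
    {𝓘 : Set (Set V)} (hI : ∀ I ∈ 𝓘, x ∉ I ∧ y ∉ I) : InterventionalMarkovEquiv 𝓘 D D' :=
  fun _ _ hp => ⟨h.isInterventionalMarkov hI hp,
    h.symm.isInterventionalMarkov (fun I h => (hI I h).symm) hp⟩

end CoveredReversal

end CausalGraph

namespace CausalGraph

/-! ### Perfect orientations and how they are connected -/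

section PerfectOrientation

variable {V : Type*} {G : SimpleGraph V} {D D₁ D₂ : Digraph V} {x y : V}

/-- An acyclic orientation of `G` in which the parents of any node form a clique. -/
structure IsPerfectOrientation (G : SimpleGraph V) (D : Digraph V) : Prop where
  isDAG : IsDAG D
  adj_iff : ∀ a b, G.Adj a b ↔ D.Adj a b ∨ D.Adj b a
  isClique : ∀ a, G.IsClique (parents D a)

/-- The graph obtained by replacing the edge `x → y` with `y → x`. -/
def reverseEdge (D : Digraph V) (x y : V) : Digraph V :=
  ⟨fun a b => D.Adj a b ∧ ¬ (a = x ∧ b = y) ∨ a = y ∧ b = x⟩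

theorem coveredReversal_reverseEdge [Finite V] (hD : IsDAG D) (hxy : D.Adj x y)
    (hcov : parents D y = insert x (parents D x)) :
    CoveredReversal D (reverseEdge D x y) x y := by
  classical
  have hne : x ≠ y := by
    rintro rfl
    exact hD.not_adj_self _ hxy
  have hcov' : ∀ a, D.Adj a y ↔ a = x ∨ D.Adj a x := fun a => Set.ext_iff.1 hcov a
  refine ⟨hD, ?_, hne, hcov, ?_, ?_, ?_⟩
  · obtain ⟨f, hf⟩ := hD.exists_ranking
    -- Doubling the ranks makes room for `y` just below `x`. The other parents of `y` are parents of
    -- `x`, so their doubled ranks are at most `2 * f x - 2`.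
    refine isDAG_of_ranking (f := Function.update (fun a => 2 * f a) y (2 * f x - 1)) ?_
    have hfxy := hf _ _ hxy
    rintro a b (⟨hab, h⟩ | ⟨rfl, rfl⟩)
    · have hfab := hf _ _ hab
      rcases eq_or_ne b y with rfl | hb
      · have hax : a ≠ x := fun h' => h ⟨h', rfl⟩
        have := hf _ _ (((hcov' a).1 hab).resolve_left hax)
        rw [Function.update_self, Function.update_of_ne (by
          rintro rfl
          exact hD.not_adj_self _ hab)]
        omega
      · rw [Function.update_of_ne hb]
        rcases eq_or_ne a y with rfl | ha
        · rw [Function.update_self]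
          omega
        · rw [Function.update_of_ne ha]
          omega
    · rw [Function.update_self, Function.update_of_ne hne]
      omega
  · ext a
    simp only [parents, reverseEdge, Set.mem_ofPred_eq, Set.mem_insert_iff]
    tauto
  · ext a
    have := hcov' a
    simp only [parents, reverseEdge, Set.mem_ofPred_eq]
    constructor
    · rintro (⟨h₁, h₂⟩ | ⟨-, h⟩)
      · exact (this.1 h₁).resolve_left fun h => h₂ ⟨h, trivial⟩
      · exact absurd h.symm hne
    · refine fun h => .inl ⟨this.2 (.inr h), ?_⟩
      rintro ⟨rfl, -⟩
      exact hD.not_adj_self _ h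
  · intro a hx hy
    ext b
    simp [parents, reverseEdge, hx, hy]

theorem IsPerfectOrientation.reverseEdge [Finite V] (h : IsPerfectOrientation G D)
    (hxy : D.Adj x y) (hcov : parents D y = insert x (parents D x)) :
    IsPerfectOrientation G (reverseEdge D x y) := by
  have hR := coveredReversal_reverseEdge h.isDAG hxy hcov
  refine ⟨hR.isDAG', fun a b => ?_, fun a => ?_⟩
  · rw [h.adj_iff]
    simp only [CausalGraph.reverseEdge]
    constructor
    · rintro (hab | hab)
      · by_cases he : a = x ∧ b = y
        · exact .inr (.inr ⟨he.2, he.1⟩)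
        · exact .inl (.inl ⟨hab, he⟩)
      · by_cases he : b = x ∧ a = y
        · exact .inl (.inr ⟨he.2, he.1⟩)
        · exact .inr (.inl ⟨hab, he⟩)
    · rintro ((hab | ⟨rfl, rfl⟩) | (hab | ⟨rfl, rfl⟩))
      exacts [.inl hab.1, .inr hxy, .inr hab.1, .inl hxy]
  · rcases eq_or_ne a x with rfl | hx
    · rw [hR.parents_left', SimpleGraph.isClique_insert]
      refine ⟨h.isClique a, fun b hb _ => (h.adj_iff _ _).2 (.inr ?_)⟩
      have : b ∈ parents D y := hcov ▸ Set.mem_insert_of_mem a hb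
      exact this
    rcases eq_or_ne a y with rfl | hy
    · rw [hR.parents_right']
      exact h.isClique x
    · rw [hR.parents_eq a hx hy]
      exact h.isClique a

/-- If two perfect orientations differ, then they differ in an edge which is covered in the
first one. -/
theorem IsPerfectOrientation.exists_covered [Finite V] (h₁ : IsPerfectOrientation G D₁)
    (h₂ : IsPerfectOrientation G D₂) (hne : D₁ ≠ D₂) :
    ∃ x y, D₁.Adj x y ∧ D₂.Adj y x ∧ parents D₁ y = insert x (parents D₁ x) := by
  obtain ⟨f, hf⟩ := h₁.isDAG.exists_ranking
  have hsplit : ∀ a b, D₁.Adj a b → D₂.Adj a b ∨ D₂.Adj b a := fun a b hab =>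
    (h₂.adj_iff a b).1 ((h₁.adj_iff a b).2 (.inl hab))
  have hex : {y | ∃ x, D₁.Adj x y ∧ D₂.Adj y x}.Nonempty := by
    by_contra hemp
    refine hne (Digraph.ext (funext₂ fun a b => propext ⟨fun hab => ?_, fun hab => ?_⟩))
    · exact (hsplit a b hab).resolve_right fun h => hemp ⟨b, a, hab, h⟩
    · exact ((h₁.adj_iff a b).1 ((h₂.adj_iff a b).2 (.inl hab))).resolve_right
        fun h => hemp ⟨a, b, h, hab⟩
  -- Take the lowest head `y` of a disagreeing edge, then its highest tail `x`. Edges of `D₁` with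
  -- head below `y` keep their direction in `D₂`.
  obtain ⟨y, hy, hmin⟩ := Set.exists_min_image _ f (Set.toFinite _) hex
  obtain ⟨x, ⟨hxy, hyx⟩, hmax⟩ := Set.exists_max_image {x | D₁.Adj x y ∧ D₂.Adj y x} f
    (Set.toFinite _) hy
  have hkeep : ∀ z w, D₁.Adj z w → f w < f y → D₂.Adj z w := fun z w hzw hlt =>
    (hsplit z w hzw).resolve_right fun h => absurd hlt (not_lt.2 (hmin w ⟨z, hzw, h⟩))
  refine ⟨x, y, hxy, hyx, Set.ext fun z => ⟨fun hzy => ?_, ?_⟩⟩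
  · by_contra hz
    simp only [Set.mem_insert_iff, not_or] at hz
    have hzx := (h₁.adj_iff z x).1 (h₁.isClique y hzy hxy hz.1)
    have hxz := hzx.resolve_left hz.2
    have hzy₂ : D₂.Adj z y := (hsplit z y hzy).resolve_right fun h =>
      absurd (hf _ _ hxz) (not_lt.2 (hmax z ⟨hzy, h⟩))
    -- A parent `z` of `y` that is neither `x` nor a parent of `x` would give the cycle `x → z → y →
    -- x` in `D₂`.
    exact h₂.isDAG x (.tail (.tail (.single (hkeep x z hxz (hf _ _ hzy))) hzy₂) hyx)
  · rintro (rfl | hzx)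
    · exact hxy
    have hzx₂ := hkeep z x hzx (hf _ _ hxy)
    have hzy : z ≠ y := by
      rintro rfl
      exact h₁.isDAG.asymm hzx hxy
    refine ((h₁.adj_iff z y).1 (h₂.isClique x hzx₂ hyx hzy)).resolve_right fun hyz => ?_
    exact h₁.isDAG x (.tail (.tail (.single hxy) hyz) hzx)

/-- Two perfect orientations are connected by reversals of covered edges; nodes with the same
parents in both of them need not be touched. -/
theorem IsPerfectOrientation.induction [Finite V] (Q : Set V) {motive : Digraph V → Prop}
    (h₂ : IsPerfectOrientation G D₂) (base : motive D₂)
    (step : ∀ D D' x y, CoveredReversal D D' x y → x ∉ Q → y ∉ Q → motive D' → motive D)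
    (h₁ : IsPerfectOrientation G D₁) (hQ : ∀ a ∈ Q, parents D₁ a = parents D₂ a) :
    motive D₁ := by
  induction hn : {e : V × V | D₁.Adj e.1 e.2 ∧ D₂.Adj e.2 e.1}.ncard using
    Nat.strong_induction_on generalizing D₁ with
  | _ n ih =>
  subst hn
  by_cases hne : D₁ = D₂
  · rwa [hne]
  obtain ⟨x, y, hxy, hyx, hcov⟩ := h₁.exists_covered h₂ hne
  have hR := coveredReversal_reverseEdge h₁.isDAG hxy hcov
  -- An endpoint of a disagreeing edge has different parents in `D₁` and `D₂`, so it is not in `Q`.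
  have hx : x ∉ Q := by
    intro hx
    have : y ∈ parents D₁ x := hQ x hx ▸ hyx
    exact h₁.isDAG.asymm hxy this
  have hy : y ∉ Q := by
    intro hy
    have : x ∈ parents D₂ y := hQ y hy ▸ hxy
    exact h₂.isDAG.asymm hyx this
  refine step _ _ x y hR hx hy (ih _ (Set.ncard_lt_ncard ?_) (h₁.reverseEdge hxy hcov)
    (fun a ha => ?_) rfl)
  · refine ⟨?_, fun hsub => ?_⟩
    · rintro ⟨a, b⟩ ⟨hab | ⟨rfl, rfl⟩, hba⟩
      · exact ⟨hab.1, hba⟩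
      · exact absurd hba (h₂.isDAG.asymm hyx)
    · rcases (hsub (show (x, y) ∈ _ from ⟨hxy, hyx⟩)).1 with h | h
      · exact h.2 ⟨rfl, rfl⟩
      · exact hR.ne h.1
  · rw [hR.parents_eq a (ne_of_mem_of_not_mem ha hx) (ne_of_mem_of_not_mem ha hy), hQ a ha]

theorem IsPerfectOrientation.markovEquiv [Fintype V] [DecidableEq V]
    (h₁ : IsPerfectOrientation G D₁) (h₂ : IsPerfectOrientation G D₂) : MarkovEquiv D₁ D₂ := by
  refine IsPerfectOrientation.induction ∅ (motive := fun D => MarkovEquiv D D₂) h₂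
    (fun _ _ _ => Iff.rfl) (fun D D' x y hR _ _ h r p hp => ?_) h₁ (by simp)
  exact (hR.markovEquiv r p hp).trans (h r p hp)

theorem IsPerfectOrientation.interventionalMarkovEquiv [Fintype V] [DecidableEq V]
    (h₁ : IsPerfectOrientation G D₁) (h₂ : IsPerfectOrientation G D₂) {v : V}
    (hv : parents D₁ v = parents D₂ v) : InterventionalMarkovEquiv {{v}} D₁ D₂ := by
  refine IsPerfectOrientation.induction {v}
    (motive := fun D => InterventionalMarkovEquiv {{v}} D D₂) h₂
    (fun _ _ _ => Iff.rfl) (fun D D' x y hR hx hy h r p hp => ?_) h₁ (by simpa using hv)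
  refine (hR.interventionalMarkovEquiv ?_ r p hp).trans (h r p hp)
  rintro I rfl
  exact ⟨hx, hy⟩

end PerfectOrientation

end CausalGraph

namespace CausalGraph

/-! ### Chordal graphs: simplicial nodes and perfect orderings -/

section Chordal

variable {V : Type*} {G : SimpleGraph V}

/-- The segment `q` joins adjacent nodes without using their edge, so it has at least two edges and
the chord is a shortcut. -/
theorem exists_shorter_walk_of_append {x y a b : V} (p : G.Walk x a) (q : G.Walk a b)
    (w : G.Walk b y) (hab : G.Adj a b) (hE : s(a, b) ∉ q.edges) :
    ∃ t : G.Walk x y, t.length < (p.append (q.append w)).length ∧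
      t.support ⊆ (p.append (q.append w)).support := by
  have h2 : 2 ≤ q.length := by
    match q, hab, hE with
    | .nil, hab, _ => exact absurd rfl hab.ne
    | .cons _ .nil, _, hE => simp at hE
    | .cons _ (.cons _ _), _, _ => simp
  refine ⟨p.append (.cons hab w), ?_, fun u hu => ?_⟩
  · simp only [SimpleGraph.Walk.length_append, SimpleGraph.Walk.length_cons]
    omega
  · simp only [SimpleGraph.Walk.mem_support_append_iff, SimpleGraph.Walk.support_cons,
      List.mem_cons] at hu ⊢
    rcases hu with h | rfl | h
    exacts [.inl h, .inl p.end_mem_support, .inr (.inr h)]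

theorem exists_shorter_walk_of_adj {x y a b : V} (p : G.Walk x y) (ha : a ∈ p.support)
    (hb : b ∈ p.support) (hab : G.Adj a b) (hE : s(a, b) ∉ p.edges) :
    ∃ q : G.Walk x y, q.length < p.length ∧ q.support ⊆ p.support := by
  classical
  have hb' := hb
  rw [← p.take_spec ha, SimpleGraph.Walk.mem_support_append_iff] at hb'
  rcases hb' with hb' | hb'
  · have hp : p = ((p.takeUntil a ha).takeUntil b hb').append
        (((p.takeUntil a ha).dropUntil b hb').append (p.dropUntil a ha)) := by
      rw [SimpleGraph.Walk.append_assoc, SimpleGraph.Walk.take_spec,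
        SimpleGraph.Walk.take_spec]
    have := exists_shorter_walk_of_append ((p.takeUntil a ha).takeUntil b hb')
      ((p.takeUntil a ha).dropUntil b hb') (p.dropUntil a ha) hab.symm fun h => hE (by
        rw [Sym2.eq_swap, hp]; simp only [SimpleGraph.Walk.edges_append, List.mem_append, h,
          true_or, or_true])
    rwa [← hp] at this
  · have hp : p = (p.takeUntil a ha).append
        (((p.dropUntil a ha).takeUntil b hb').append ((p.dropUntil a ha).dropUntil b hb')) := by
      rw [SimpleGraph.Walk.take_spec, SimpleGraph.Walk.take_spec]
    have := exists_shorter_walk_of_append (p.takeUntil a ha)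
      ((p.dropUntil a ha).takeUntil b hb') ((p.dropUntil a ha).dropUntil b hb') hab
      fun h => hE (by
        rw [hp]; simp only [SimpleGraph.Walk.edges_append, List.mem_append, h, true_or, or_true])
    rwa [← hp] at this

/-- In a chordal graph, two neighbors of `v` joined by a walk whose inner nodes are neither `v`
nor neighbors of `v` are adjacent. -/
theorem IsChordal.adj_of_walk (hG : IsChordal G) {v x y : V} (hx : G.Adj v x) (hy : G.Adj v y)
    (hxy : x ≠ y) (p : G.Walk x y)
    (hp : ∀ u ∈ p.support, u = x ∨ u = y ∨ u ≠ v ∧ ¬ G.Adj v u) : G.Adj x y := by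
  classical
  by_contra hn
  induction hlen : p.length using Nat.strong_induction_on generalizing p with
  | _ n ih =>
  subst hlen
  have hmin : ∀ q : G.Walk x y, q.support ⊆ p.support → p.length ≤ q.length := by
    intro q hq
    by_contra hlt
    exact ih _ (not_le.1 hlt) q (fun u hu => hp u (hq hu)) rfl
  have hpath : p.IsPath := by
    have h₁ := hmin p.bypass p.support_bypass_subset_support
    have := p.bypass_eq_self_of_length_le_length_bypass h₁
    rw [← this]
    exact p.bypass_isPath
  have hv : v ∉ p.support := by
    intro h
    rcases hp v h with rfl | rfl | h
    exacts [hx.ne rfl, hy.ne rfl, h.1 rfl]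
  have h2 : 2 ≤ p.length := by
    by_contra hlt
    have : p.length = 0 ∨ p.length = 1 := by omega
    rcases this with h | h
    · exact hxy (SimpleGraph.Walk.eq_of_length_eq_zero h)
    · exact hn (SimpleGraph.Walk.adj_of_length_eq_one h)
  -- A shortest walk closes up through `v` to a cycle of length at least four. A chord at `v` would
  -- need an inner neighbor of `v`, and any other chord would shorten the walk.
  have hcyc : (SimpleGraph.Walk.cons hx (p.concat hy.symm)).IsCycle := by
    rw [SimpleGraph.Walk.cons_isCycle_iff]
    refine ⟨hpath.concat hv hy.symm, ?_⟩
    rw [SimpleGraph.Walk.edges_concat, List.concat_eq_append, List.mem_append]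
    rintro (h | h)
    · exact hv (p.fst_mem_support_of_mem_edges h)
    · simp only [List.mem_singleton, Sym2.eq_iff] at h
      rcases h with h | h
      exacts [hy.ne h.1, hxy h.2]
  obtain ⟨a, b, ha, hb, hab, hE⟩ := hG v _ hcyc (by simp; omega)
  simp only [SimpleGraph.Walk.support_cons, SimpleGraph.Walk.support_concat,
    List.mem_cons, List.mem_append, List.not_mem_nil, or_false] at ha hb
  simp only [SimpleGraph.Walk.edges_cons, SimpleGraph.Walk.edges_concat,
    List.concat_eq_append, List.mem_cons, List.mem_append, List.not_mem_nil, or_false,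
    not_or] at hE
  have hva : ∀ u, u ∈ p.support → G.Adj v u → u = x ∨ u = y := by
    intro u hu hvu
    rcases hp u hu with h | h | h
    exacts [.inl h, .inr h, absurd hvu h.2]
  have ha' : a = v ∨ a ∈ p.support := by tauto
  have hb' : b = v ∨ b ∈ p.support := by tauto
  rcases ha' with rfl | ha'
  · rcases hb' with rfl | hb'
    · exact hab.ne rfl
    · rcases hva b hb' hab with rfl | rfl
      · exact hE.1 rfl
      · exact hE.2.2 Sym2.eq_swap
  · rcases hb' with rfl | hb'
    · rcases hva a ha' hab.symm with rfl | rfl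
      · exact hE.1 Sym2.eq_swap
      · exact hE.2.2 rfl
    · obtain ⟨q, hq, hqs⟩ := exists_shorter_walk_of_adj p ha' hb' hab hE.2.1
      exact absurd (hmin q hqs) (not_le.2 hq)

/-- The graph induced on `S` has a simplicial node outside of any clique `C ≠ S`. -/
theorem IsChordal.exists_simplicial (hG : IsChordal G) (S C : Finset V) (hCS : C ⊂ S)
    (hC : G.IsClique (C : Set V)) :
    ∃ s ∈ S, s ∉ C ∧ G.IsClique {t | t ∈ S ∧ G.Adj s t} := by
  classical
  induction hn : S.card using Nat.strong_induction_on generalizing S C with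
  | _ n ih =>
  subst hn
  wlog hne : C.Nonempty generalizing C
  · obtain rfl := Finset.not_nonempty_iff_eq_empty.1 hne
    obtain ⟨v, hv⟩ : S.Nonempty := Finset.nonempty_of_ne_empty hCS.ne'
    rcases eq_or_ne S {v} with rfl | hSv
    · refine ⟨v, hv, by simp, ?_⟩
      intro a ha
      have := Finset.mem_singleton.1 ha.1
      exact absurd ha.2 (by rw [this]; exact G.loopless.irrefl v)
    · obtain ⟨s, hs, -, h⟩ := this {v} ((Finset.singleton_subset_iff.2 hv).ssubset_of_ne hSv.symm)
        (by simp) (Finset.singleton_nonempty v)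
      exact ⟨s, hs, by simp, h⟩
  -- If `C` dominates `S`, a node simplicial in `S \ C` remains simplicial in `S`.
  by_cases hdom : ∀ c ∈ C, ∀ t ∈ S, t ≠ c → G.Adj c t
  · have hlt : (S \ C).card < S.card := Finset.card_lt_card (Finset.sdiff_ssubset hCS.1 hne)
    obtain ⟨s, hs, -, h⟩ := ih _ hlt (S \ C) ∅
      (Finset.empty_ssubset.2 (Finset.sdiff_nonempty.2 hCS.2)) (by simp) rfl
    rw [Finset.mem_sdiff] at hs
    refine ⟨s, hs.1, hs.2, fun a ha b hb hab => ?_⟩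
    by_cases haC : a ∈ C
    · exact hdom a haC b hb.1 hab.symm
    by_cases hbC : b ∈ C
    · exact (hdom b hbC a ha.1 hab).symm
    · exact h ⟨Finset.mem_sdiff.2 ⟨ha.1, haC⟩, ha.2⟩ ⟨Finset.mem_sdiff.2 ⟨hb.1, hbC⟩, hb.2⟩ hab
  push Not at hdom
  obtain ⟨v, hvC, k₀, hk₀S, hk₀v, hk₀⟩ := hdom
  -- `K` is the component of `k₀` among the nodes of `S` outside the closed neighborhood of `v`, and
  -- `N` is its boundary. `N` is a clique by chordality, so induction applies to `K ∪ N`, which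
  -- omits `v`, with the clique `N`.
  let U : Set V := {u | u ∈ S ∧ u ≠ v ∧ ¬ G.Adj v u}
  let K : Set V := {u | ∃ p : G.Walk k₀ u, ∀ w ∈ p.support, w ∈ U}
  let N : Set V := {u | u ∈ S ∧ u ∉ U ∧ ∃ k ∈ K, G.Adj k u}
  have hKU : K ⊆ U := fun u ⟨p, hp⟩ => hp u p.end_mem_support
  have hk₀K : k₀ ∈ K := 
    ⟨.nil, fun w hw => by rw [List.mem_singleton.1 hw]; exact ⟨hk₀S, hk₀v, hk₀⟩⟩
  have hNv : ∀ u ∈ N, G.Adj v u := by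
    rintro u ⟨huS, huU, k, hk, hku⟩
    by_contra hvu
    refine huU ⟨huS, ?_, hvu⟩
    rintro rfl
    exact (hKU hk).2.2 hku.symm
  have hNclique : G.IsClique N := by
    intro x hx y hy hxy
    obtain ⟨-, -, k, ⟨p, hp⟩, hkx⟩ := id hx
    obtain ⟨-, -, l, ⟨q, hq⟩, hly⟩ := id hy
    refine hG.adj_of_walk (hNv x hx) (hNv y hy) hxy
      (.cons hkx.symm ((p.reverse.append q).concat hly)) fun u hu => ?_
    simp only [SimpleGraph.Walk.support_cons, SimpleGraph.Walk.support_concat,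
      List.mem_cons, List.mem_append, List.not_mem_nil, or_false,
      SimpleGraph.Walk.mem_support_append_iff, SimpleGraph.Walk.support_reverse,
      List.mem_reverse] at hu
    rcases hu with h | (h | h) | h
    · exact .inl h
    · exact .inr (.inr (hp u h).2)
    · exact .inr (.inr (hq u h).2)
    · exact .inr (.inl h)
  have hcard : (S.filter (· ∈ K ∪ N)).card < S.card := by
    refine Finset.card_lt_card (Finset.filter_ssubset.2 ⟨v, hCS.1 hvC, ?_⟩)
    rintro (h | h)
    exacts [(hKU h).2.1 rfl, (hNv v h).ne rfl]
  have hNss : S.filter (· ∈ N) ⊂ S.filter (· ∈ K ∪ N) := by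
    refine ⟨fun u hu => ?_, fun h => ?_⟩
    · rw [Finset.mem_filter] at hu ⊢
      exact ⟨hu.1, .inr hu.2⟩
    · have := h (Finset.mem_filter.2 ⟨hk₀S, .inl hk₀K⟩)
      exact (Finset.mem_filter.1 this).2.2.1 (hKU hk₀K)
  obtain ⟨s, hs, hsN, h⟩ := ih _ hcard _ _ hNss
    (hNclique.subset fun u hu => (Finset.mem_filter.1 hu).2) rfl
  rw [Finset.mem_filter] at hs hsN
  have hsK : s ∈ K := hs.2.resolve_right fun h => hsN ⟨hs.1, h⟩
  -- A node of `K` is not adjacent to `v ∈ C`, so it is outside `C`; all its neighbors in `S` lie in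
  -- `K ∪ N`.
  refine ⟨s, hs.1, fun hsC => (hKU hsK).2.2 (hC hvC hsC (hKU hsK).2.1.symm), h.subset ?_⟩
  rintro t ⟨htS, hst⟩
  refine ⟨Finset.mem_filter.2 ⟨htS, ?_⟩, hst⟩
  by_cases htU : t ∈ U
  · obtain ⟨p, hp⟩ := hsK
    refine .inl ⟨p.concat hst, fun w hw => ?_⟩
    rw [SimpleGraph.Walk.support_concat, List.mem_append] at hw
    rcases hw with hw | hw
    · exact hp w hw
    · rwa [List.mem_singleton.1 hw]
  · exact .inr ⟨htS, htU, s, hsK, hst⟩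

/-- The function `f` orders the nodes in `S` such that the preceding neighbors of any node form a
clique. -/
def IsPerfectOrdering (G : SimpleGraph V) (S : Finset V) (f : V → ℤ) : Prop :=
  Set.InjOn f S ∧ ∀ a ∈ S, G.IsClique {b | b ∈ S ∧ G.Adj a b ∧ f b < f a}

theorem IsPerfectOrdering.exists_insert [DecidableEq V] {S : Finset V} {f : V → ℤ}
    (hf : IsPerfectOrdering G S f) {s : V} (hs : s ∉ S)
    (hcl : G.IsClique {t | t ∈ S ∧ G.Adj s t}) :
    ∃ f', IsPerfectOrdering G (insert s S) f' ∧ (∀ a ∈ S, f' a = f a) ∧ ∀ a ∈ S, f a < f' s := by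
  obtain ⟨m, hm⟩ : ∃ m : ℤ, ∀ a ∈ S, f a < m := by
    obtain ⟨m, hm⟩ := (S.image f).bddAbove
    exact ⟨m + 1, fun a ha => Int.lt_add_one_of_le (hm (by simpa using ⟨a, ha, rfl⟩))⟩
  have hS : ∀ a ∈ S, Function.update f s m a = f a := fun a ha =>
    Function.update_of_ne (ne_of_mem_of_not_mem ha hs) _ _
  have hs' : Function.update f s m s = m := Function.update_self _ _ _
  refine ⟨Function.update f s m, ⟨?_, ?_⟩, hS, fun a ha => hs'.symm ▸ hm a ha⟩
  · rw [Finset.coe_insert, Set.injOn_insert (by simpa using hs)]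
    refine ⟨hf.1.congr fun a ha => (hS a ha).symm, ?_⟩
    rintro ⟨a, ha, h⟩
    rw [hS a ha, hs'] at h
    exact (hm a ha).ne h
  · intro a ha
    rcases Finset.mem_insert.1 ha with rfl | ha'
    · refine hcl.subset ?_
      rintro b ⟨hb, hab, -⟩
      exact ⟨(Finset.mem_insert.1 hb).resolve_left hab.ne', hab⟩
    · refine (hf.2 a ha').subset ?_
      rintro b ⟨hb, hab, hlt⟩
      rw [hS a ha'] at hlt
      rcases Finset.mem_insert.1 hb with rfl | hb
      · rw [hs'] at hlt
        exact absurd hlt (hm a ha').asymm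
      · rw [hS b hb] at hlt
        exact ⟨hb, hab, hlt⟩

/-- Simplicial nodes outside `C` are removed one at a time, and each is put last when it is
restored. -/
theorem IsChordal.exists_isPerfectOrdering_extending [DecidableEq V] (hG : IsChordal G)
    {C : Finset V} (hC : G.IsClique (C : Set V)) {f : V → ℤ} (hf : IsPerfectOrdering G C f)
    (S : Finset V) (hCS : C ⊆ S) :
    ∃ f', IsPerfectOrdering G S f' ∧ (∀ a ∈ C, f' a = f a) ∧
      ∀ a ∈ C, ∀ b ∈ S, b ∉ C → f a < f' b := by
  induction S using Finset.strongInduction with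
  | H S ih =>
    rcases hCS.eq_or_ssubset with rfl | hss
    · exact ⟨f, hf, fun _ _ => rfl, fun a _ b hb hb' => absurd hb hb'⟩
    obtain ⟨s, hs, hsC, hcl⟩ := hG.exists_simplicial S C hss hC
    have hCe : ∀ a ∈ C, a ∈ S.erase s := fun a ha =>
      Finset.mem_erase.2 ⟨fun h => hsC (h ▸ ha), hCS ha⟩
    have hcl' : G.IsClique {t | t ∈ S.erase s ∧ G.Adj s t} := by
      refine hcl.subset ?_
      rintro t ⟨ht, hst⟩
      exact ⟨Finset.mem_of_mem_erase ht, hst⟩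
    obtain ⟨g, hg, hgC, hlt⟩ := ih (S.erase s) (Finset.erase_ssubset hs) hCe
    obtain ⟨f', hf', hfS, hfs⟩ := hg.exists_insert (Finset.notMem_erase s S) hcl'
    rw [Finset.insert_erase hs] at hf'
    refine ⟨f', hf', fun a ha => (hfS a (hCe a ha)).trans (hgC a ha), fun a ha b hb hbC => ?_⟩
    rcases eq_or_ne b s with rfl | hbs
    · exact hgC a ha ▸ hfs a (hCe a ha)
    · have hb' := Finset.mem_erase.2 ⟨hbs, hb⟩
      rw [hfS b hb']
      exact hlt a ha b hb' hbC

/-- A clique in the neighborhood of `v` is the set of preceding neighbors of `v` in some perfect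
ordering. -/
theorem IsChordal.exists_isPerfectOrdering [Fintype V] [DecidableEq V] (hG : IsChordal G) {v : V}
    {P : Set V} (hP : P ⊆ G.neighborSet v) (hPc : G.IsClique P) :
    ∃ f, IsPerfectOrdering G Finset.univ f ∧ {b | G.Adj v b ∧ f b < f v} = P := by
  classical
  have hvP : v ∉ P.toFinset := by
    rw [Set.mem_toFinset]
    exact fun h => (hP h : G.Adj v v).ne rfl
  -- Inside a clique any enumeration is a perfect ordering.
  have h₀ : IsPerfectOrdering G P.toFinset fun a => (Fintype.equivFin V a : ℤ) := by
    refine ⟨fun a _ b _ h => ?_, fun a _ => hPc.subset fun b hb => by simpa using hb.1⟩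
    exact (Fintype.equivFin V).injective (Fin.ext (Int.ofNat.inj h))
  obtain ⟨g, hg, hgP, hgv⟩ := h₀.exists_insert hvP
    (hPc.subset fun t ht => by simpa using ht.1)
  have hC : G.IsClique ((insert v P.toFinset : Finset V) : Set V) := by
    rw [Finset.coe_insert, Set.coe_toFinset, SimpleGraph.isClique_insert]
    exact ⟨hPc, fun b hb _ => hP hb⟩
  obtain ⟨f, hf, hfC, hlt⟩ :=
    hG.exists_isPerfectOrdering_extending hC hg Finset.univ (Finset.subset_univ _)
  have hv := hfC v (Finset.mem_insert_self _ _)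
  refine ⟨f, hf, Set.ext fun b => ⟨fun ⟨hvb, hb⟩ => ?_, fun hb => ⟨hP hb, ?_⟩⟩⟩
  · by_contra hbP
    exact (hv ▸ hb).asymm (hlt v (Finset.mem_insert_self _ _) b (Finset.mem_univ b)
      (by simp [hvb.ne', hbP]))
  · have hbP : b ∈ P.toFinset := Set.mem_toFinset.2 hb
    rw [hv, hfC b (Finset.mem_insert_of_mem hbP), hgP b hbP]
    exact hgv b hbP

end Chordal

end CausalGraph

namespace CausalGraph

/-! ### Coin distributions -/

section Empirical

variable {V T : Type*} [Fintype V] [DecidableEq V] [Fintype T] {w : T → V → Fin 2}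

/-- The distribution of `w t` for a uniformly distributed `t`. -/
noncomputable def empirical (w : T → V → Fin 2) (y : V → Fin 2) : ℝ :=
  ∑ t, if y = w t then (Fintype.card T : ℝ)⁻¹ else 0

open Classical in
theorem marginal_empirical (S : Set V) (x : V → Fin 2) :
    marginal (r := fun _ => 2) (empirical w) S x =
      ∑ t, if ∀ a ∈ S, w t a = x a then (Fintype.card T : ℝ)⁻¹ else 0 := by
  unfold marginal empirical
  have : ∀ y : V → Fin 2, (if ∀ a ∈ S, y a = x a then
      ∑ t, (if y = w t then (Fintype.card T : ℝ)⁻¹ else 0) else 0) =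
      ∑ t, if y = w t then (if ∀ a ∈ S, w t a = x a then (Fintype.card T : ℝ)⁻¹ else 0) else 0 := by
    intro y
    split_ifs with h
    · refine Finset.sum_congr rfl fun t _ => ?_
      split_ifs with h₁ h₂ <;> first | rfl | exact absurd (h₁ ▸ h) h₂
    · refine (Finset.sum_eq_zero fun t _ => ?_).symm
      split_ifs with h₁ h₂ <;> first | rfl | exact absurd (h₁ ▸ h₂) h
  rw [Finset.sum_congr rfl fun y _ => this y, Finset.sum_comm]
  simp

theorem empirical_mem_stdSimplex [Nonempty T] :
    empirical w ∈ stdSimplex ℝ (∀ _ : V, Fin 2) := by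
  refine ⟨fun y => Finset.sum_nonneg fun t _ => ?_, ?_⟩
  · split_ifs <;> positivity
  · unfold empirical
    rw [Finset.sum_comm]
    simp

/-- The conditional law of `d` is a point mass. That one factor `g` serves all `S` containing `C` is
what gives conditional independence. -/
theorem marginal_empirical_insert_of_determined {d : V} {C : Set V}
    (hC : ∀ t t', (∀ b ∈ C, w t b = w t' b) → w t d = w t' d) :
    ∃ g : (V → Fin 2) → ℝ, ∀ S, C ⊆ S → ∀ x,
      marginal (r := fun _ => 2) (empirical w) (insert d S) x =
        g x * marginal (r := fun _ => 2) (empirical w) S x := by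
  classical
  refine ⟨fun x => if ∃ t, (∀ b ∈ C, w t b = x b) ∧ w t d = x d then 1 else 0,
    fun S hS x => ?_⟩
  simp only [marginal_empirical, Finset.mul_sum, Set.forall_mem_insert]
  refine Finset.sum_congr rfl fun t _ => ?_
  by_cases hx : ∀ b ∈ S, w t b = x b
  · have : (∃ t, (∀ b ∈ C, w t b = x b) ∧ w t d = x d) ↔ w t d = x d := by
      refine ⟨fun ⟨t', h₁, h₂⟩ => ?_, fun h => ⟨t, fun b hb => hx b (hS hb), h⟩⟩
      rw [← h₂]
      exact hC t t' fun b hb => (hx b (hS hb)).trans (h₁ b hb).symm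
    simp only [this, eq_true hx, and_true, if_true, ite_mul, one_mul, zero_mul]
  · simp only [eq_false hx, and_false, if_false, mul_zero]

theorem marginal_empirical_insert_of_const {d : V} {i : Fin 2} (hd : ∀ t, w t d = i)
    (S : Set V) (x : V → Fin 2) :
    marginal (r := fun _ => 2) (empirical w) (insert d S) x =
      if x d = i then marginal (r := fun _ => 2) (empirical w) S x else 0 := by
  classical
  simp only [marginal_empirical, Set.forall_mem_insert, hd, eq_comm (a := i)]
  split_ifs with h <;> simp [h]

/-- The involution pairs samples that agree on `S` and differ at `d`, so each value at `d` receives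
half the mass. -/
theorem marginal_empirical_insert_of_flip {d : V} {S : Set V} {σ : T → T}
    (hσ : Function.Involutive σ) (hd : ∀ t, w (σ t) d ≠ w t d)
    (hS : ∀ t, ∀ e ∈ S, w (σ t) e = w t e) (x : V → Fin 2) :
    marginal (r := fun _ => 2) (empirical w) (insert d S) x =
      1 / 2 * marginal (r := fun _ => 2) (empirical w) S x := by
  classical
  have hflip : ∀ t, w (σ t) d = x d ↔ ¬ w t d = x d := by
    intro t
    have := hd t
    omega
  let F : T → ℝ := fun t =>
    if w t d = x d ∧ ∀ a ∈ S, w t a = x a then (Fintype.card T : ℝ)⁻¹ else 0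
  have h₁ : ∑ t, F (σ t) = ∑ t, F t := Equiv.sum_comp hσ.toPerm F
  have h₂ : ∀ t, (if ∀ a ∈ S, w t a = x a then (Fintype.card T : ℝ)⁻¹ else 0) =
      F t + F (σ t) := by
    intro t
    have : (∀ a ∈ S, w (σ t) a = x a) ↔ ∀ a ∈ S, w t a = x a :=
      forall₂_congr fun a ha => by rw [hS t a ha]
    simp only [F, hflip, this]
    by_cases h : w t d = x d <;> simp [h]
  have h₃ : marginal (r := fun _ => 2) (empirical w) (insert d S) x = ∑ t, F t := by
    simp only [marginal_empirical, Set.forall_mem_insert, F]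
  rw [h₃, marginal_empirical, Finset.sum_congr rfl fun t _ => h₂ t, Finset.sum_add_distrib, h₁]
  ring

/-- A distribution is Markov if each variable is a function of its parents or a fair coin not used
by its non-descendants. -/
theorem isMarkov_empirical {D : Digraph V} (hD : IsDAG D)
    (h : ∀ d, (∀ t t', (∀ b ∈ parents D d, w t b = w t' b) → w t d = w t' d) ∨
      ∃ σ : T → T, Function.Involutive σ ∧ (∀ t, w (σ t) d ≠ w t d) ∧
        ∀ t, ∀ e ∈ nonDescendants D d, w (σ t) e = w t e) :
    IsMarkov (r := fun _ => 2) D (empirical w) := by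
  intro d x
  have hN := hD.parents_subset_nonDescendants d
  obtain ⟨g, hg⟩ : ∃ g : (V → Fin 2) → ℝ, ∀ S, parents D d ⊆ S → S ⊆ nonDescendants D d →
      ∀ x, marginal (r := fun _ => 2) (empirical w) (insert d S) x =
        g x * marginal (r := fun _ => 2) (empirical w) S x := by
    rcases h d with h | ⟨σ, hσ, hd, hS⟩
    · obtain ⟨g, hg⟩ := marginal_empirical_insert_of_determined h
      exact ⟨g, fun S hS _ => hg S hS⟩
    · exact ⟨fun _ => 1 / 2, fun S _ hSN =>
        marginal_empirical_insert_of_flip hσ hd fun t e he => hS t e (hSN he)⟩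
  rw [Set.union_assoc, Set.union_eq_self_of_subset_right hN, ← Set.insert_eq, ← Set.insert_eq,
    hg _ hN subset_rfl, hg _ subset_rfl hN]
  ring

/-- Two equal coins at `a` and `b`. -/
def coupledCoins (a b : V) (t : Fin 2) (d : V) : Fin 2 :=
  if d = a ∨ d = b then t else 0

/-- Two independent coins at `a` and `b`. -/
def independentCoins (a b : V) (t : Fin 2 × Fin 2) (d : V) : Fin 2 :=
  if d = a then t.1 else if d = b then t.2 else 0

/-- Two independent coins at `a` and `b` and their sum modulo two at `c`. -/
def parityCoins (a b c : V) (t : Fin 2 × Fin 2) (d : V) : Fin 2 :=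
  if d = a then t.1 else if d = b then t.2 else if d = c then t.1 + t.2 else 0

theorem add_one_involutive : Function.Involutive fun t : Fin 2 => t + 1 := by
  intro t
  fin_cases t <;> rfl

-- The all-zero configuration alone suffices to refute independence in the tests below.
open Classical in
theorem marginal_coupledCoins (a b : V) (S : Set V) :
    marginal (r := fun _ => 2) (empirical (coupledCoins a b)) S (fun _ => 0) =
      if a ∈ S ∨ b ∈ S then 1 / 2 else 1 := by
  have : ∀ t, (∀ d ∈ S, coupledCoins a b t d = 0) ↔ (a ∈ S ∨ b ∈ S → t = 0) := by
    intro t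
    constructor
    · rintro h (ha | hb)
      · simpa [coupledCoins] using h a ha
      · simpa [coupledCoins] using h b hb
    · intro h d hd
      unfold coupledCoins
      split_ifs with hab
      · rcases hab with rfl | rfl
        exacts [h (.inl hd), h (.inr hd)]
      · rfl
  simp only [marginal_empirical, this, Fin.sum_univ_two, Fintype.card_fin]
  by_cases h : a ∈ S ∨ b ∈ S <;> simp [h]
  norm_num

open Classical in
theorem marginal_independentCoins {a b : V} (hab : a ≠ b) (S : Set V) :
    marginal (r := fun _ => 2) (empirical (independentCoins a b)) S (fun _ => 0) =
      (if a ∈ S then 1 / 2 else 1) * if b ∈ S then 1 / 2 else 1 := by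
  have : ∀ t, (∀ d ∈ S, independentCoins a b t d = 0) ↔
      (a ∈ S → t.1 = 0) ∧ (b ∈ S → t.2 = 0) := by
    intro t
    constructor
    · intro h
      refine ⟨fun ha => ?_, fun hb => ?_⟩
      · simpa [independentCoins] using h a ha
      · simpa [independentCoins, hab.symm] using h b hb
    · intro h d hd
      unfold independentCoins
      split_ifs with h₁ h₂
      exacts [h.1 (h₁ ▸ hd), h.2 (h₂ ▸ hd), rfl]
  simp only [marginal_empirical, this, Fintype.sum_prod_type, Fin.sum_univ_two,
    Fintype.card_prod, Fintype.card_fin]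
  by_cases ha : a ∈ S <;> by_cases hb : b ∈ S <;> simp [ha, hb] <;> norm_num

open Classical in
theorem marginal_parityCoins {a b c : V} (hab : a ≠ b) (hac : a ≠ c) (hbc : b ≠ c) (S : Set V) :
    marginal (r := fun _ => 2) (empirical (parityCoins a b c)) S (fun _ => 0) =
      if a ∈ S ∧ b ∈ S ∨ a ∈ S ∧ c ∈ S ∨ b ∈ S ∧ c ∈ S then 1 / 4
      else if a ∈ S ∨ b ∈ S ∨ c ∈ S then 1 / 2 else 1 := by
  have : ∀ t, (∀ d ∈ S, parityCoins a b c t d = 0) ↔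
      (a ∈ S → t.1 = 0) ∧ (b ∈ S → t.2 = 0) ∧ (c ∈ S → t.1 + t.2 = 0) := by
    intro t
    constructor
    · intro h
      refine ⟨fun ha => ?_, fun hb => ?_, fun hc => ?_⟩
      · simpa [parityCoins] using h a ha
      · simpa [parityCoins, hab.symm] using h b hb
      · simpa [parityCoins, hac.symm, hbc.symm] using h c hc
    · intro h d hd
      unfold parityCoins
      split_ifs with h₁ h₂ h₃
      exacts [h.1 (h₁ ▸ hd), h.2.1 (h₂ ▸ hd), h.2.2 (h₃ ▸ hd), rfl]
  simp only [marginal_empirical, this, Fintype.sum_prod_type, Fin.sum_univ_two,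
    Fintype.card_prod, Fintype.card_fin]
  by_cases ha : a ∈ S <;> by_cases hb : b ∈ S <;> by_cases hc : c ∈ S <;>
    simp [ha, hb, hc] <;> norm_num

end Empirical

/-! ### What equivalent DAGs have in common -/

section Necessity

variable {V : Type*} [Fintype V] [DecidableEq V] {D D' : Digraph V} {a b c v : V}

theorem isMarkov_coupledCoins (hD : IsDAG D) (hab : D.Adj a b) :
    IsMarkov (r := fun _ => 2) D (empirical (coupledCoins a b)) := by
  refine isMarkov_empirical hD fun d => ?_
  rcases eq_or_ne d a with rfl | ha
  · refine .inr ⟨_, add_one_involutive, fun t => ?_, fun t e he => ?_⟩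
    · simp [coupledCoins]
    · have : e ≠ b := by
        rintro rfl
        exact he.2 (.single hab)
      simp [coupledCoins, he.1, this]
  · refine .inl fun t t' h => ?_
    rcases eq_or_ne d b with rfl | hb
    · simpa [coupledCoins] using h a hab
    · simp [coupledCoins, ha, hb]

/-- By acyclicity one of `a`, `b` is a non-descendant of the other. Without an edge, the Markov
property would make two equal coins independent given constants, so that 1/2 = 1/4. -/
theorem adj_of_isMarkov_coupledCoins (hD : IsDAG D) (hab : a ≠ b)
    (h : IsMarkov (r := fun _ => 2) D (empirical (coupledCoins a b))) :
    D.Adj a b ∨ D.Adj b a := by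
  by_contra hn
  rw [not_or] at hn
  have hba : b ≠ a := hab.symm
  by_cases hr : Relation.TransGen D.Adj a b
  · have hN : a ∈ nonDescendants D b := ⟨hab, fun h => hD a (hr.trans h)⟩
    have hb : b ∉ parents D b := hD.not_adj_self b
    have ha : a ∉ parents D b := hn.1
    have := h b fun _ => 0
    simp only [marginal_coupledCoins] at this
    norm_num [hN, hb, ha, hab] at this
  · have hN : b ∈ nonDescendants D a := ⟨hba, hr⟩
    have hb : b ∉ parents D a := hn.2
    have ha : a ∉ parents D a := hD.not_adj_self a
    have := h a fun _ => 0
    simp only [marginal_coupledCoins] at this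
    norm_num [hN, hb, ha, hba] at this

theorem MarkovEquiv.adj_or_adj (h : MarkovEquiv D D') (hD : IsDAG D) (hD' : IsDAG D')
    (hab : D.Adj a b) : D'.Adj a b ∨ D'.Adj b a := by
  have hne : a ≠ b := by
    rintro rfl
    exact hD.not_adj_self _ hab
  exact adj_of_isMarkov_coupledCoins hD' hne
    ((h (fun _ => 2) _ empirical_mem_stdSimplex).1 (isMarkov_coupledCoins hD hab))

theorem isMarkov_parityCoins (hD : IsDAG D) (hac : D.Adj a c) (hbc : D.Adj b c) (hab : a ≠ b) :
    IsMarkov (r := fun _ => 2) D (empirical (parityCoins a b c)) := by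
  have hac' : a ≠ c := by
    rintro rfl
    exact hD.not_adj_self _ hac
  have hbc' : b ≠ c := by
    rintro rfl
    exact hD.not_adj_self _ hbc
  refine isMarkov_empirical hD fun d => ?_
  rcases eq_or_ne d a with rfl | ha
  · refine .inr ⟨fun t => (t.1 + 1, t.2), fun t => Prod.ext (add_one_involutive t.1) rfl,
      fun t => ?_, fun t e he => ?_⟩
    · simp [parityCoins]
    · have : e ≠ c := by
        rintro rfl
        exact he.2 (.single hac)
      simp [parityCoins, he.1, this]
  rcases eq_or_ne d b with rfl | hb
  · refine .inr ⟨fun t => (t.1, t.2 + 1), fun t => Prod.ext rfl (add_one_involutive t.2),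
      fun t => ?_, fun t e he => ?_⟩
    · simp [parityCoins, hab.symm]
    · have : e ≠ c := by
        rintro rfl
        exact he.2 (.single hbc)
      simp [parityCoins, he.1, this]
  · refine .inl fun t t' h => ?_
    rcases eq_or_ne d c with rfl | hc
    · have h₁ := h a hac
      have h₂ := h b hbc
      simp only [parityCoins, if_true, hab.symm, if_false] at h₁ h₂
      simp [parityCoins, hac'.symm, hbc'.symm, h₁, h₂]
    · simp [parityCoins, ha, hb, hc]

theorem adj_of_isMarkov_parityCoins (hD : IsDAG D) (hab : a ≠ b)
    (hnab : ¬ D.Adj a b) (hnba : ¬ D.Adj b a) (hac : D.Adj a c ∨ D.Adj c a)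
    (hbc : D.Adj b c ∨ D.Adj c b)
    (h : IsMarkov (r := fun _ => 2) D (empirical (parityCoins a b c))) :
    D.Adj a c ∧ D.Adj b c := by
  have hac' : a ≠ c := by
    rintro rfl
    exact hD.not_adj_self _ (or_self_iff.1 hac)
  have hbc' : b ≠ c := by
    rintro rfl
    exact hD.not_adj_self _ (or_self_iff.1 hbc)
  have hba := hab.symm
  -- Given the parity at `c`, the coins at `a` and `b` determine each other. So if `c` is a parent
  -- of `a` and `b` is not, `b` must be a descendant of `a`.
  have key₁ : D.Adj c a → Relation.TransGen D.Adj a b := by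
    intro hca
    by_contra hr
    have h₁ : b ∈ nonDescendants D a := ⟨hba, hr⟩
    have h₂ : b ∉ parents D a := hnba
    have h₃ : a ∉ parents D a := hD.not_adj_self a
    have h₄ : c ∈ parents D a := hca
    have h₅ : a ∉ nonDescendants D a := fun h => h.1 rfl
    have := h a fun _ => 0
    simp only [marginal_parityCoins hab hac' hbc'] at this
    norm_num [h₁, h₂, h₃, h₄, h₅, hba] at this
  have key₂ : D.Adj c b → Relation.TransGen D.Adj b a := by
    intro hcb
    by_contra hr
    have h₁ : a ∈ nonDescendants D b := ⟨hab, hr⟩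
    have h₂ : a ∉ parents D b := hnab
    have h₃ : b ∉ parents D b := hD.not_adj_self b
    have h₄ : c ∈ parents D b := hcb
    have h₅ : b ∉ nonDescendants D b := fun h => h.1 rfl
    have := h b fun _ => 0
    simp only [marginal_parityCoins hab hac' hbc'] at this
    norm_num [h₁, h₂, h₃, h₄, h₅, hab] at this
  refine ⟨hac.resolve_right fun hca => ?_, hbc.resolve_right fun hcb => ?_⟩
  · rcases hbc with hbc | hcb
    · exact hD a (((key₁ hca).tail hbc).tail hca)
    · exact hD a ((key₁ hca).trans (key₂ hcb))
  · rcases hac with hac | hca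
    · exact hD b (((key₂ hcb).tail hac).tail hcb)
    · exact hD a ((key₁ hca).trans (key₂ hcb))

theorem MarkovEquiv.collider (h : MarkovEquiv D D') (hD : IsDAG D) (hD' : IsDAG D')
    (hac : D.Adj a c) (hbc : D.Adj b c) (hab : a ≠ b) (hnab : ¬ D'.Adj a b)
    (hnba : ¬ D'.Adj b a) : D'.Adj a c ∧ D'.Adj b c :=
  adj_of_isMarkov_parityCoins hD' hab hnab hnba (h.adj_or_adj hD hD' hac)
    (h.adj_or_adj hD hD' hbc)
    ((h (fun _ => 2) _ empirical_mem_stdSimplex).1 (isMarkov_parityCoins hD hac hbc hab))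

theorem isMarkov_independentCoins (hD : IsDAG D) (hab : a ≠ b) :
    IsMarkov (r := fun _ => 2) D (empirical (independentCoins a b)) := by
  refine isMarkov_empirical hD fun d => ?_
  rcases eq_or_ne d a with rfl | ha
  · refine .inr ⟨fun t => (t.1 + 1, t.2), fun t => Prod.ext (add_one_involutive t.1) rfl,
      fun t => ?_, fun t e he => ?_⟩
    · simp [independentCoins]
    · simp [independentCoins, he.1]
  rcases eq_or_ne d b with rfl | hb
  · refine .inr ⟨fun t => (t.1, t.2 + 1), fun t => Prod.ext rfl (add_one_involutive t.2),
      fun t => ?_, fun t e he => ?_⟩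
    · simp [independentCoins, hab.symm]
    · simp [independentCoins, he.1]
  · exact .inl fun t t' h => by simp [independentCoins, ha, hb]

theorem sameCond_coins {S : Set V} (hbv : b ≠ v) {d : V} (hd : d ≠ v) (hS : d ∉ S)
    (hvS : d = b → v ∉ S) :
    SameCond (r := fun _ => 2) (empirical (coupledCoins b v)) (empirical (independentCoins b v))
      d S := by
  intro x
  rcases eq_or_ne d b with rfl | hb
  · rw [marginal_empirical_insert_of_flip add_one_involutive,
      marginal_empirical_insert_of_flip (σ := fun t : Fin 2 × Fin 2 => (t.1 + 1, t.2))
        (fun t => Prod.ext (add_one_involutive t.1) rfl)]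
    · ring
    · intro t
      simp [independentCoins]
    · intro t e he
      simp [independentCoins, ne_of_mem_of_not_mem he hS]
    · intro t
      simp [coupledCoins]
    · intro t e he
      simp [coupledCoins, ne_of_mem_of_not_mem he hS, ne_of_mem_of_not_mem he (hvS rfl)]
  · rw [marginal_empirical_insert_of_const (i := 0) (fun t => by simp [coupledCoins, hb, hd]),
      marginal_empirical_insert_of_const (i := 0) (fun t => by simp [independentCoins, hb, hd])]
    split_ifs <;> ring

theorem SameCond.symm {r : V → ℕ} {p q : (∀ a, Fin (r a)) → ℝ} {S : Set V}
    (h : SameCond p q a S) : SameCond q p a S :=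
  fun x => (h x).symm

open Classical in
/-- Equal coins at `b` and `v`, which become independent under an intervention. -/
noncomputable def coinFamily (b v : V) (I : Set V) : (V → Fin 2) → ℝ :=
  if I = ∅ then empirical (coupledCoins b v) else empirical (independentCoins b v)

/-- Intervening at `v` cuts `b → v`, which frees the coin at `v`; all other nodes keep their
conditionals, as `v` is not a parent of `b`. -/
theorem isInterventionalMarkov_coinFamily (hD : IsDAG D) (hbv : D.Adj b v) :
    IsInterventionalMarkov (r := fun _ => 2) D {{v}} (coinFamily b v) := by
  have hne : b ≠ v := by
    rintro rfl
    exact hD.not_adj_self _ hbv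
  have hsame : ∀ d ≠ v, SameCond (r := fun _ => 2) (empirical (coupledCoins b v))
      (empirical (independentCoins b v)) d (parents D d) := fun d hd =>
    sameCond_coins hne hd (hD.not_adj_self d) (by
      rintro rfl
      exact hD.asymm hbv)
  refine ⟨?_, ?_⟩
  · rintro I (rfl | rfl)
    · rw [interventionGraph_empty, coinFamily, if_pos rfl]
      exact isMarkov_coupledCoins hD hbv
    · rw [coinFamily, if_neg (Set.singleton_ne_empty v)]
      exact isMarkov_independentCoins (hD.interventionGraph _) hne
  · rintro I (rfl | rfl) J (rfl | rfl) d hI hJ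
    · exact fun x => rfl
    · rw [coinFamily, coinFamily, if_pos rfl, if_neg (Set.singleton_ne_empty v)]
      exact hsame d hJ
    · rw [coinFamily, coinFamily, if_pos rfl, if_neg (Set.singleton_ne_empty v)]
      exact (hsame d hI).symm
    · exact fun x => rfl

/-- The observational law forces adjacency. With `v → b`, the law of `b` given its parents would
have to survive the intervention, but it changes from a copy of the coin at `v` to a fair coin. -/
theorem adj_of_isInterventionalMarkov_coinFamily (hD : IsDAG D) (hbv : b ≠ v)
    (h : IsInterventionalMarkov (r := fun _ => 2) D {{v}} (coinFamily b v)) : D.Adj b v := by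
  have h₀ := h.1 ∅ (by simp)
  rw [interventionGraph_empty, coinFamily, if_pos rfl] at h₀
  refine (adj_of_isMarkov_coupledCoins hD hbv h₀).resolve_right fun hvb => ?_
  have := h.2 ∅ (by simp) {v} (by simp) b (by simp) (by simpa using hbv) fun _ => 0
  rw [coinFamily, coinFamily, if_pos rfl, if_neg (Set.singleton_ne_empty v)] at this
  have h₁ : v ∈ parents D b := hvb
  have h₂ : b ∉ parents D b := hD.not_adj_self b
  simp only [marginal_coupledCoins, marginal_independentCoins hbv] at this
  norm_num [h₁, h₂] at this

theorem InterventionalMarkovEquiv.parents_eq (h : InterventionalMarkovEquiv {{v}} D D')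
    (hD : IsDAG D) (hD' : IsDAG D') : parents D v = parents D' v := by
  have hmem : ∀ b, ∀ I ∈ (insert ∅ {{v}} : Set (Set V)),
      coinFamily b v I ∈ stdSimplex ℝ (∀ _ : V, Fin 2) := by
    intro b I _
    unfold coinFamily
    split_ifs <;> exact empirical_mem_stdSimplex
  ext b
  rcases eq_or_ne b v with rfl | hne
  · exact iff_of_false (hD.not_adj_self b) (hD'.not_adj_self b)
  · have := h (fun _ => 2) (coinFamily b v) (hmem b)
    exact ⟨fun hb => adj_of_isInterventionalMarkov_coinFamily hD' hne
      (this.1 (isInterventionalMarkov_coinFamily hD hb)),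
      fun hb => adj_of_isInterventionalMarkov_coinFamily hD hne
      (this.2 (isInterventionalMarkov_coinFamily hD' hb))⟩

end Necessity

end CausalGraph

namespace CausalGraph

/-! ### The Markov equivalence class of a chordal graph -/

section DagsOf

variable {V : Type*} {G : SimpleGraph V} {D D₁ D₂ : Digraph V}

theorem IsPerfectOrdering.isPerfectOrientation [Fintype V] {f : V → ℤ}
    (hf : IsPerfectOrdering G Finset.univ f) :
    IsPerfectOrientation G ⟨fun a b => G.Adj a b ∧ f a < f b⟩ where
  isDAG := isDAG_of_ranking fun _ _ h => h.2
  adj_iff a b := by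
    refine ⟨fun h => ?_, fun h => h.elim And.left fun h => h.1.symm⟩
    have : f a ≠ f b := fun he => h.ne (hf.1 (by simp) (by simp) he)
    rcases this.lt_or_gt with hlt | hlt
    exacts [.inl ⟨h, hlt⟩, .inr ⟨h.symm, hlt⟩]
  isClique a := (hf.2 a (Finset.mem_univ a)).subset fun b hb =>
    show b ∈ Finset.univ ∧ G.Adj a b ∧ f b < f a from ⟨Finset.mem_univ b, hb.1.symm, hb.2⟩

theorem IsPerfectOrientation.parents_subset (h : IsPerfectOrientation G D) (v : V) :
    parents D v ⊆ G.neighborSet v :=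
  fun b hb => (h.adj_iff v b).2 (.inr hb)

variable [Fintype V] [DecidableEq V]

theorem IsChordal.exists_isPerfectOrientation (hG : IsChordal G) {v : V} {P : Set V}
    (hP : P ⊆ G.neighborSet v) (hPc : G.IsClique P) :
    ∃ D, IsPerfectOrientation G D ∧ parents D v = P := by
  obtain ⟨f, hf, hfP⟩ := hG.exists_isPerfectOrdering hP hPc
  refine ⟨_, hf.isPerfectOrientation, ?_⟩
  rw [← hfP]
  ext b
  exact and_congr_left' (G.adj_comm b v)

theorem MarkovEquiv.symm (h : MarkovEquiv D₁ D₂) : MarkovEquiv D₂ D₁ :=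
  fun r p hp => (h r p hp).symm

theorem mem_dagsOf_iff (hG : IsChordal G) : D ∈ dagsOf G ↔ IsPerfectOrientation G D := by
  constructor
  · rintro ⟨hD, hess⟩
    have hadj : ∀ a b, G.Adj a b ↔ ∃ D', IsDAG D' ∧ MarkovEquiv D D' ∧ D'.Adj a b := fun a b =>
      (congrFun₂ (congrArg Digraph.Adj hess) a b).symm.to_iff
    have hsub : ∀ {a b}, D.Adj a b → G.Adj a b := fun hab =>
      (hadj _ _).2 ⟨D, hD, fun _ _ _ => Iff.rfl, hab⟩
    refine ⟨hD, fun a b => ⟨fun h => ?_, fun h => h.elim hsub fun h => (hsub h).symm⟩,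
      fun c a hac b hbc hab => ?_⟩
    · obtain ⟨D', hD', hDD', hab⟩ := (hadj a b).1 h
      exact hDD'.symm.adj_or_adj hD' hD hab
    · by_contra hn
      -- Since `G` is undirected, some equivalent `D'` has `c → a`. With `a` and `b` not adjacent in
      -- `G`, hence not in `D'`, the collider at `c` would force `a → c` there too.
      obtain ⟨D', hD', hDD', hca⟩ := (hadj c a).1 (hsub hac).symm
      exact hD'.asymm hca (hDD'.collider hD hD' hac hbc hab
        (fun h => hn ((hadj a b).2 ⟨D', hD', hDD', h⟩))
        (fun h => hn ((hadj b a).2 ⟨D', hD', hDD', h⟩).symm)).1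
  · intro h
    refine ⟨h.isDAG, Digraph.ext (funext₂ fun a b => propext ⟨?_, fun hab => ?_⟩)⟩
    · rintro ⟨D', hD', hDD', hab⟩
      exact (h.adj_iff a b).2 (hDD'.symm.adj_or_adj hD' h.isDAG hab)
    · obtain ⟨D', hD', hpar⟩ := hG.exists_isPerfectOrientation (v := b) (P := {a})
        (Set.singleton_subset_iff.2 (SimpleGraph.Adj.symm hab)) (SimpleGraph.isClique_singleton a)
      have hab' : a ∈ parents D' b := hpar ▸ Set.mem_singleton a
      exact ⟨D', hD'.isDAG, h.markovEquiv hD', hab'⟩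

theorem interventionalEssentialGraph_congr {𝓘 : Set (Set V)}
    (h : InterventionalMarkovEquiv 𝓘 D₁ D₂) :
    interventionalEssentialGraph 𝓘 D₁ = interventionalEssentialGraph 𝓘 D₂ := by
  have : ∀ D', InterventionalMarkovEquiv 𝓘 D₁ D' ↔ InterventionalMarkovEquiv 𝓘 D₂ D' :=
    fun D' => forall₃_congr fun r p hp => by rw [h r p hp]
  simp only [interventionalEssentialGraph, this]

/-- Equivalent DAGs share the parents of `v`, so the union of edge sets adds no edge into `v`. -/
theorem parents_interventionalEssentialGraph (hD : IsDAG D) (v : V) :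
    parents (interventionalEssentialGraph {{v}} D) v = parents D v := by
  refine Set.Subset.antisymm ?_ fun b hb => ⟨D, hD, fun _ _ _ => Iff.rfl, hb⟩
  rintro b ⟨D', hD', hDD', hb⟩
  rw [hDD'.parents_eq hD hD']
  exact hb

end DagsOf

end CausalGraph

/-! ### The bijection with cliques -/

theorem proposition1 {V : Type*} [Fintype V] [DecidableEq V] (G : SimpleGraph V)
    (hG : CausalGraph.IsChordal G) (v : V) :
    (∀ D₁ ∈ CausalGraph.dagsOf G, ∀ D₂ ∈ CausalGraph.dagsOf G,
      CausalGraph.parents D₁ v = CausalGraph.parents D₂ v →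
        CausalGraph.interventionalEssentialGraph {{v}} D₁ =
          CausalGraph.interventionalEssentialGraph {{v}} D₂) ∧
    ∃ Φ : Set V → Digraph V,
      Set.BijOn Φ {P : Set V | P ⊆ G.neighborSet v ∧ G.IsClique P}
        (CausalGraph.interventionResultSpace {{v}} G) ∧
      ∀ D ∈ CausalGraph.dagsOf G,
        (CausalGraph.parents D v ⊆ G.neighborSet v ∧ G.IsClique (CausalGraph.parents D v)) ∧
        Φ (CausalGraph.parents D v) = CausalGraph.interventionalEssentialGraph {{v}} D := by
  open CausalGraph in
  have hdet : ∀ D₁ ∈ dagsOf G, ∀ D₂ ∈ dagsOf G, parents D₁ v = parents D₂ v →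
      interventionalEssentialGraph {{v}} D₁ = interventionalEssentialGraph {{v}} D₂ :=
    fun D₁ h₁ D₂ h₂ hv => interventionalEssentialGraph_congr
      (((mem_dagsOf_iff hG).1 h₁).interventionalMarkovEquiv ((mem_dagsOf_iff hG).1 h₂) hv)
  have hpar : ∀ D ∈ dagsOf G, parents D v ⊆ G.neighborSet v ∧ G.IsClique (parents D v) :=
    fun D h => ⟨((mem_dagsOf_iff hG).1 h).parents_subset v, ((mem_dagsOf_iff hG).1 h).isClique v⟩
  have hex : ∀ P : Set V, ∃ D, P ⊆ G.neighborSet v ∧ G.IsClique P →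
      D ∈ dagsOf G ∧ parents D v = P := by
    intro P
    by_cases hP : P ⊆ G.neighborSet v ∧ G.IsClique P
    · obtain ⟨D, hD, hDP⟩ := hG.exists_isPerfectOrientation hP.1 hP.2
      exact ⟨D, fun _ => ⟨(mem_dagsOf_iff hG).2 hD, hDP⟩⟩
    -- An arbitrary value: `Φ` is defined on all sets, but only cliques of neighbors of `v` matter.
    · exact ⟨⟨fun _ _ => False⟩, fun h => absurd h hP⟩
  choose orient horient using hex
  have hΦ : ∀ D ∈ dagsOf G, interventionalEssentialGraph {{v}} (orient (parents D v)) =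
      interventionalEssentialGraph {{v}} D := fun D hD =>
    hdet _ (horient _ (hpar D hD)).1 D hD (horient _ (hpar D hD)).2
  refine ⟨hdet, fun P => interventionalEssentialGraph {{v}} (orient P),
    ⟨fun P hP => ⟨_, (horient P hP).1, rfl⟩, fun P hP Q hQ h => ?_, ?_⟩,
    fun D hD => ⟨hpar D hD, hΦ D hD⟩⟩
  · rw [← (horient P hP).2, ← (horient Q hQ).2,
      ← parents_interventionalEssentialGraph (horient P hP).1.1,
      ← parents_interventionalEssentialGraph (horient Q hQ).1.1]
    exact congrArg (parents · v) h
  · rintro _ ⟨D, hD, rfl⟩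
    exact ⟨parents D v, hpar D hD, hΦ D hD⟩
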